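/- **Setting.** Write points of $\mathbb{R}^{1+2}$ as $(t,x)$, $x=(x^1,x^2)$, $r=|x|$, $\langle\rho\rangle=(1+\rho^2)^{1/2}$. Fix a smooth cut-off $\chi:\mathbb{R}\to\mathbb{R}$ with $\chi=0$ on $(-\infty,0]$, $\chi=1$ on $[1,\infty)$, and, on $(0,1)$, $\chi'>0$ and $|\chi'|+|\chi''|\le K\chi^{1/2}$ for some constant $K$. For $s\ge 2$ put $\rho_H(s)=(s^2-1)/2$, $\xi(s,r)=1-\chi(r-\rho_H(s))$ and $$T(s,r)=s+\int_0^r\frac{\xi(s,\rho)\,\rho}{(s^2+\rho^2)^{1/2}}\,d\rho .$$ The transition part and the flat part of the slice $\{t=T(s,|x|)\}$ are $$\mathcal T_s=\{(T(s,r),x):\rho_H(s)\le r\le\rho_H(s)+1\},\qquad \mathcal P_s=\{(T(s,r),x): r\ge\rho_H(s)+1\};$$ put $\mathcal{TP}_s=\mathcal T_s\cup\mathcal P_s$ and $\mathcal{TP}_{[s_0,s_1]}=\bigcup_{s_0\le s\le s_1}\mathcal{TP}_s$. Let $\aleph:\mathbb{R}\to\mathbb{R}$ be nondecreasing with $\aleph(y)=0$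 for $y\le0$ and $\aleph(y)=y+1$ for $y\ge1$, and put $\omega(t,r)=1+\aleph(2+r-t)$. For $\alpha\in\{0,1,2\}$ and $a\in\{1,2\}$ let $\partial_0=\partial_t$, $\partial_a=\partial_{x^a}$, $L_a=x^a\partial_t+t\partial_a$, $\Omega=x^1\partial_2-x^2\partial_1$, and $$\tilde\partial_a=\frac{x^a}{r}\partial_t+\partial_a,\qquad \bar\partial_a=\frac{\xi(s,r)x^a}{(s^2+r^2)^{1/2}}\partial_t+\partial_a,\qquad \zeta=\Big(1-\frac{\xi(s,r)^2r^2}{s^2+r^2}\Big)^{1/2}.$$ Define the weighted energy $$E_\eta^{\mathcal{TP}}(s,u)=\int_{\{|x|\ge\rho_H(s)\}}\omega^{2\eta}\Big(|\zeta\,\partial_tu|^2+\sum_{a=1,2}|\bar\partial_au|^2\Big)\Big|_{t=T(s,|x|)}\,dx\in[0,\infty],$$ and $E_\eta^{\mathcal{TP},3}(s,u)=\sum_ZE_\eta^{\mathcal{TP}}(s,Zu)$, the sum being over all compositions $Z$ of at most three of the vector fields $\partial_0,\partial_1,\partial_2,L_1,L_2,\Omega$ (including $Z=\mathrm{id}$).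 **Proposition.** There is a constant $C>0$, depending only on $\chi$, such that the following holds for all $2\le s_0\le s_1$ and all $\eta\in(0,1)$. Let $u$ be a real function of class $C^4$ on an open neighbourhood of $\mathcal{TP}_{[s_0,s_1]}$. Then for every $s\in[s_0,s_1]$, every $(t,x)\in\mathcal{TP}_s$, all $\alpha\in\{0,1,2\}$ and all $a\in\{1,2\}$, $$\langle r\rangle^{1/2}\,\omega^{\eta}\,|\partial_\alpha u(t,x)|+\langle r\rangle^{1/2+\eta}\,|\tilde\partial_au(t,x)|\le C\,(1-\eta)^{-1}\,E_\eta^{\mathcal{TP},3}(s,u)^{1/2}.$$ No decay of $u$ at spatial infinity is required beyond the finiteness of the right-hand side (the inequality is trivial when $E_\eta^{\mathcal{TP},3}(s,u)=\infty$). -/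

import Mathlib

open Set MeasureTheory
open scoped ENNReal ContDiff

noncomputable section

namespace EuclHyp

/-- The plane with its Euclidean norm and Lebesgue measure. -/
abbrev Plane : Type := EuclideanSpace ℝ (Fin 2)

/-- Points `(t, x)` of `ℝ^{1+2}`. -/
abbrev Spacetime : Type := ℝ × Plane

/-! ### The cut-off function, the weight profile, and the foliation -/

/-- The cut-off functions from which the foliation is built: smooth, `0` on `(-∞, 0]`, `1` on
`[1, ∞)`, and on `(0, 1)` with positive derivative and `|χ'| + |χ''| ≲ χ^{1/2}`. -/
structure IsCutoff (χ : ℝ → ℝ) : Prop where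
  smooth : ContDiff ℝ ∞ χ
  eq_one : ∀ x, 1 ≤ x → χ x = 1
  eq_zero : ∀ x, x ≤ 0 → χ x = 0
  deriv_pos : ∀ x ∈ Ioo (0 : ℝ) 1, 0 < deriv χ x
  deriv_bound : ∃ K : ℝ, ∀ x ∈ Ioo (0 : ℝ) 1,
    |deriv χ x| + |deriv (deriv χ) x| ≤ K * Real.sqrt (χ x)

/-- The profile of the weight: nondecreasing, `0` on `(-∞, 0]` and `r + 1` on `[1, ∞)`.
(Under the additional bound `ℵ' ≤ 2` it would have to be `2 r` on `[0, 1]`; no upper bound on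
the slope is imposed.) -/
structure IsWeightProfile (aleph : ℝ → ℝ) : Prop where
  eq_zero : ∀ r, r ≤ 0 → aleph r = 0
  eq_add_one : ∀ r, 1 ≤ r → aleph r = r + 1
  mono : Monotone aleph

/-- The Japanese bracket `⟨ρ⟩ = (1 + ρ²)^{1/2}`. -/
def bracket (ρ : ℝ) : ℝ := Real.sqrt (1 + ρ ^ 2)

/-- `ρ_H(s) = (s² - 1)/2`. -/
def rhoH (s : ℝ) : ℝ := (s ^ 2 - 1) / 2

/-- `ξ(s, r) = 1 - χ(r - ρ_H(s))`. -/
def xi (χ : ℝ → ℝ) (s r : ℝ) : ℝ := 1 - χ (r - rhoH s)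

/-- The slope `ξ(s, r) r / (s² + r²)^{1/2}` of the slice of parameter `s`. -/
def slope (χ : ℝ → ℝ) (s r : ℝ) : ℝ := xi χ s r * r / Real.sqrt (s ^ 2 + r ^ 2)

/-- The time function: the solution of `∂_r T = ξ(s, r) r / (s² + r²)^{1/2}`, `T(s, 0) = s`. -/
def timeFn (χ : ℝ → ℝ) (s r : ℝ) : ℝ := s + ∫ ρ in (0 : ℝ)..r, slope χ s ρ

/-- The point of the slice `{t = T(s, |x|)}` above `x`. -/
def slicePoint (χ : ℝ → ℝ) (s : ℝ) (x : Plane) : Spacetime := (timeFn χ s ‖x‖, x)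

/-- The annulus below the transition part of the slice of parameter `s`. -/
def transBase (s : ℝ) : Set Plane := {x | rhoH s ≤ ‖x‖ ∧ ‖x‖ ≤ rhoH s + 1}

/-- The exterior of the disc below the flat part of the slice of parameter `s`. -/
def flatBase (s : ℝ) : Set Plane := {x | rhoH s + 1 ≤ ‖x‖}

/-- The transition part of the slice of parameter `s`. -/
def transSlice (χ : ℝ → ℝ) (s : ℝ) : Set Spacetime := slicePoint χ s '' transBase s

/-- The flat part of the slice of parameter `s`. -/
def flatSlice (χ : ℝ → ℝ) (s : ℝ) : Set Spacetime := slicePoint χ s '' flatBase s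

/-- The exterior (transition and flat) part of the slice of parameter `s`. -/
def tpSlice (χ : ℝ → ℝ) (s : ℝ) : Set Spacetime := transSlice χ s ∪ flatSlice χ s

/-- The transition-flat region between the slices of parameters `s₀` and `s₁`. -/
def tpRegion (χ : ℝ → ℝ) (s₀ s₁ : ℝ) : Set Spacetime := ⋃ s ∈ Icc s₀ s₁, tpSlice χ s

/-- The weight `ω(t, r) = 1 + ℵ(2 + r - t)`. -/
def weight (aleph : ℝ → ℝ) (t r : ℝ) : ℝ := 1 + aleph (2 + r - t)

/-! ### Vector fields -/

/-- `∂_t u`. -/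
def dt (u : Spacetime → ℝ) (p : Spacetime) : ℝ := fderiv ℝ u p (1, 0)

/-- `∂_a u`, with `a = 0, 1` standing for the two space directions. -/
def dx (a : Fin 2) (u : Spacetime → ℝ) (p : Spacetime) : ℝ :=
  fderiv ℝ u p (0, EuclideanSpace.single a 1)

/-- `∂_α u`, with `α = 0` the time direction. -/
def pd (α : Fin 3) (u : Spacetime → ℝ) : Spacetime → ℝ :=
  Fin.cases (dt u) (fun a => dx a u) α

/-- The Lorentzian boost `L_a = x^a ∂_t + t ∂_a`. -/
def boost (a : Fin 2) (u : Spacetime → ℝ) (p : Spacetime) : ℝ :=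
  p.2 a * dt u p + p.1 * dx a u p

/-- The rotation `Ω = x^1 ∂_2 - x^2 ∂_1`. -/
def rot (u : Spacetime → ℝ) (p : Spacetime) : ℝ :=
  p.2 0 * dx 1 u p - p.2 1 * dx 0 u p

/-- The semi-null derivative `(x^a / r) ∂_t + ∂_a`. -/
def nullD (a : Fin 2) (u : Spacetime → ℝ) (p : Spacetime) : ℝ :=
  p.2 a / ‖p.2‖ * dt u p + dx a u p

/-- The derivative `ξ(s, r) x^a / (s² + r²)^{1/2} ∂_t + ∂_a`, tangent to the slice of
parameter `s` at the points of that slice. -/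
def tangD (χ : ℝ → ℝ) (s : ℝ) (a : Fin 2) (u : Spacetime → ℝ) (p : Spacetime) : ℝ :=
  xi χ s ‖p.2‖ * p.2 a / Real.sqrt (s ^ 2 + ‖p.2‖ ^ 2) * dt u p + dx a u p

/-- Labels of the vector fields `∂_α` (left), and `L_a`, `Ω` (right). -/
abbrev Field : Type := Fin 3 ⊕ (Fin 2 ⊕ Unit)

/-- The action of a single vector field. -/
def Field.act : Field → (Spacetime → ℝ) → Spacetime → ℝ
  | .inl α => pd α
  | .inr (.inl a) => boost a
  | .inr (.inr _) => rot

/-- The action of the composition `Z_0 Z_1 ⋯ Z_{n-1}`. -/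
def compose {n : ℕ} (Z : Fin n → Field) (u : Spacetime → ℝ) : Spacetime → ℝ :=
  (List.ofFn Z).foldr Field.act u

/-- The number of boosts and rotations in a composition. -/
def rank {n : ℕ} (Z : Fin n → Field) : ℕ :=
  (Finset.univ.filter fun i => (Z i).isRight = true).card

/-! ### Energies -/

/-- `ζ = (1 - ξ² r² / (s² + r²))^{1/2}`. -/
def zeta (χ : ℝ → ℝ) (s r : ℝ) : ℝ :=
  Real.sqrt (1 - xi χ s r ^ 2 * r ^ 2 / (s ^ 2 + r ^ 2))

/-- The energy density on the slice of parameter `s`. -/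
def density (χ : ℝ → ℝ) (s : ℝ) (u : Spacetime → ℝ) (p : Spacetime) : ℝ :=
  (zeta χ s ‖p.2‖ * dt u p) ^ 2 + ∑ a : Fin 2, (tangD χ s a u p) ^ 2

/-- The energy with weight `ω^{2η}` on the part of the slice of parameter `s` above `B`. -/
def energyOn (χ aleph : ℝ → ℝ) (B : Set Plane) (η s : ℝ) (u : Spacetime → ℝ) : ℝ≥0∞ :=
  ∫⁻ x in B, ENNReal.ofReal
    (weight aleph (timeFn χ s ‖x‖) ‖x‖ ^ (2 * η) * density χ s u (slicePoint χ s x))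

/-- The weighted energy on the transition-flat part of the slice of parameter `s`. -/
def energyTP (χ aleph : ℝ → ℝ) (η s : ℝ) (u : Spacetime → ℝ) : ℝ≥0∞ :=
  energyOn χ aleph (transBase s) η s u + energyOn χ aleph (flatBase s) η s u

/-- The weighted energy of order `p` and rank `k` on the transition-flat part: the sum of the
energies of `Z u` over all compositions `Z` of at most `p` vector fields, at most `k` of which
are boosts or rotations. -/
def energyTPOrd (χ aleph : ℝ → ℝ) (p k : ℕ) (η s : ℝ) (u : Spacetime → ℝ) : ℝ≥0∞ :=
  ∑ n ∈ Finset.range (p + 1), ∑ Z : Fin n → Field,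
    if rank Z ≤ k then energyTP χ aleph η s (compose Z u) else 0

end EuclHyp

end

/-!
On a fixed slice, `∂u` is estimated by a Sobolev inequality in polar coordinates: a trace in the
radial variable over `r < |x| < r + 2`, then a Sobolev inequality on the circle. Where the slice
is curved, the energy sees `∂_t u` only through the small factor `ζ`, so the radial trace averages
over `r + 1 < |x| < r + 2` alone. That annulus lies in the flat part, where the density is the
full gradient; the zeroth-order terms and the commutators `[Ω, ∂_α]` are therefore bounded by the
energy. The weight `ω` is nondecreasing along the slice and comes out of the integral.

For the null derivatives, `∂̃_a = L_a / t + (x^a / r) ((t - r) / t) ∂_t`. The second term is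
harmless since `|t - r| ≤ ω`. For the first, the gradient bound holds for `L_a u` as well and is
integrated along the slice inward from `r = 2 ρ_H + 2`, where `L_a u` is bounded through `∂u`
because `t`, `r` and `ω` are all comparable to `ρ_H`; the integral of `(r - ρ_H + 2)^{-η}` gives
the factor `(1 - η)⁻¹`. Beyond that radius `ω` is comparable to `r` and the gradient bound suffices.
-/

namespace EuclHyp

section Sobolev

variable {E : Type*} [NormedAddCommGroup E]

theorem sq_lintegral_le {X : Type*} [MeasurableSpace X] {μ : Measure X} {f : X → ℝ≥0∞}
    (hf : AEMeasurable f μ) : (∫⁻ x, f x ∂μ) ^ 2 ≤ μ univ * ∫⁻ x, f x ^ 2 ∂μ := by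
  have hölder := ENNReal.lintegral_mul_le_Lp_mul_Lq μ Real.HolderConjugate.two_two hf
    (aemeasurable_const (b := (1 : ℝ≥0∞)))
  simp only [Pi.mul_apply, mul_one, ENNReal.rpow_ofNat, one_pow, lintegral_const, one_mul]
    at hölder
  calc (∫⁻ x, f x ∂μ) ^ 2
      ≤ ((∫⁻ x, f x ^ 2 ∂μ) ^ (1 / 2 : ℝ) * μ univ ^ (1 / 2 : ℝ)) ^ 2 := by gcongr
    _ = μ univ * ∫⁻ x, f x ^ 2 ∂μ := by
      have sq_sqrt (c : ℝ≥0∞) : (c ^ (1 / 2 : ℝ)) ^ 2 = c := by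
        rw [← ENNReal.rpow_mul_natCast]; norm_num
      rw [mul_pow, sq_sqrt, sq_sqrt, mul_comm]

theorem enorm_sq_eq_ofReal (x : ℝ) : ‖x‖ₑ ^ 2 = ENNReal.ofReal (x ^ 2) := by
  rw [Real.enorm_eq_ofReal_abs, ← ENNReal.ofReal_pow (abs_nonneg x), sq_abs]

theorem enorm_sq_le_two_mul_add (x y : E) : ‖x‖ₑ ^ 2 ≤ 2 * ‖y‖ₑ ^ 2 + 2 * ‖x - y‖ₑ ^ 2 := by
  have convexity := ENNReal.rpow_add_le_mul_rpow_add_rpow ‖y‖ₑ ‖x - y‖ₑ one_le_two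
  norm_num at convexity
  calc ‖x‖ₑ ^ 2 = ‖y + (x - y)‖ₑ ^ 2 := by rw [add_sub_cancel]
    _ ≤ (‖y‖ₑ + ‖x - y‖ₑ) ^ 2 := by gcongr; exact enorm_add_le _ _
    _ ≤ 2 * ‖y‖ₑ ^ 2 + 2 * ‖x - y‖ₑ ^ 2 := by rwa [← mul_add]

variable [NormedSpace ℝ E] [CompleteSpace E]

theorem enorm_sub_sq_le_lintegral_deriv {f f' : ℝ → E} {a b x y : ℝ}
    (hf : ∀ z ∈ Icc a b, HasDerivAt f (f' z) z) (hf' : IntegrableOn f' (Icc a b))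
    (hx : x ∈ Icc a b) (hy : y ∈ Icc a b) :
    ‖f x - f y‖ₑ ^ 2 ≤ ENNReal.ofReal (b - a) * ∫⁻ z in Ioo a b, ‖f' z‖ₑ ^ 2 := by
  have hyx : uIcc y x ⊆ Icc a b := uIcc_subset_Icc hy hx
  have ftc : ∫ z in y..x, f' z = f x - f y :=
    intervalIntegral.integral_eq_sub_of_hasDerivAt (fun z hz => hf z (hyx hz))
      (hf'.mono_set hyx).intervalIntegrable
  have meas : AEMeasurable (fun z => ‖f' z‖ₑ) (volume.restrict (Ioo a b)) :=
    (hf'.mono_set Ioo_subset_Icc_self).aestronglyMeasurable.enorm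
  have hsub : ‖f x - f y‖ₑ ≤ ∫⁻ z in Ioo a b, ‖f' z‖ₑ := by
    rw [← ftc, ← ofReal_norm, intervalIntegral.norm_intervalIntegral_eq, ofReal_norm]
    refine (enorm_integral_le_lintegral_enorm _).trans ?_
    rw [restrict_Ioo_eq_restrict_Icc]
    exact lintegral_mono_set (uIoc_subset_uIcc.trans hyx)
  calc ‖f x - f y‖ₑ ^ 2 ≤ (∫⁻ z in Ioo a b, ‖f' z‖ₑ) ^ 2 := by gcongr
    _ ≤ ENNReal.ofReal (b - a) * ∫⁻ z in Ioo a b, ‖f' z‖ₑ ^ 2 := by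
      simpa using sq_lintegral_le meas

theorem volume_mul_enorm_sq_le {f f' : ℝ → E} {a b x : ℝ} {S : Set ℝ} (hS : MeasurableSet S)
    (hSab : S ⊆ Icc a b) (hf : ∀ z ∈ Icc a b, HasDerivAt f (f' z) z)
    (hf' : IntegrableOn f' (Icc a b)) (hx : x ∈ Icc a b) :
    volume S * ‖f x‖ₑ ^ 2 ≤ 2 * (∫⁻ z in S, ‖f z‖ₑ ^ 2) +
      volume S * (2 * ENNReal.ofReal (b - a) * ∫⁻ z in Ioo a b, ‖f' z‖ₑ ^ 2) := by
  have pointwise : ∀ y ∈ S, ‖f x‖ₑ ^ 2 ≤ 2 * ‖f y‖ₑ ^ 2 +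
      2 * ENNReal.ofReal (b - a) * ∫⁻ z in Ioo a b, ‖f' z‖ₑ ^ 2 := fun y hy => by
    refine (enorm_sq_le_two_mul_add (f x) (f y)).trans ?_
    rw [mul_assoc 2 (ENNReal.ofReal _)]
    gcongr
    exact enorm_sub_sq_le_lintegral_deriv hf hf' hx (hSab hy)
  have averaged := setLIntegral_mono' (μ := volume) hS pointwise
  rwa [setLIntegral_const, lintegral_add_right _ measurable_const,
    lintegral_const_mul' _ _ ENNReal.ofNat_ne_top, setLIntegral_const, mul_comm (‖f x‖ₑ ^ 2),
    mul_comm (_ * _) (volume S)] at averaged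

theorem volume_mul_lintegral_enorm_sq_le {f f' : ℝ × ℝ → E} {a b x : ℝ} {S A : Set ℝ}
    (hS : MeasurableSet S) (hA : MeasurableSet A) (hSab : S ⊆ Icc a b)
    (hf : ∀ θ ∈ A, ∀ r ∈ Icc a b, HasDerivAt (fun ρ => f (ρ, θ)) (f' (r, θ)) r)
    (hfc : ContinuousOn f (Icc a b ×ˢ A)) (hf'c : ContinuousOn f' (Icc a b ×ˢ A))
    (hx : x ∈ Icc a b) :
    volume S * (∫⁻ θ in A, ‖f (x, θ)‖ₑ ^ 2) ≤ 2 * (∫⁻ z in S ×ˢ A, ‖f z‖ₑ ^ 2) +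
      volume S * (2 * ENNReal.ofReal (b - a) * ∫⁻ z in Ioo a b ×ˢ A, ‖f' z‖ₑ ^ 2) := by
  have meas {g : ℝ × ℝ → E} (hg : ContinuousOn g (Icc a b ×ˢ A)) {B : Set ℝ}
      (hB : MeasurableSet B) (hBab : B ⊆ Icc a b) :
      AEMeasurable (fun z => ‖g z‖ₑ ^ 2) ((volume.restrict B).prod (volume.restrict A)) := by
    rw [Measure.prod_restrict]
    exact ((hg.mono (prod_mono_left hBab)).enorm.aemeasurable (hB.prod hA)).pow_const 2
  have hm := meas hfc hS hSab
  have hm' := meas hf'c measurableSet_Ioo Ioo_subset_Icc_self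
  have fiberwise := setLIntegral_mono' (μ := volume) hA fun θ hθ =>
    volume_mul_enorm_sq_le hS hSab (hf θ hθ)
      (ContinuousOn.integrableOn_Icc
        (hf'c.comp (t := Icc a b ×ˢ A) (by fun_prop) fun ρ hρ => ⟨hρ, hθ⟩)) hx
  have hSfin : volume S ≠ ⊤ := measure_ne_top_of_subset hSab measure_Icc_lt_top.ne
  rw [lintegral_const_mul' _ _ hSfin, lintegral_add_left' (hm.lintegral_prod_left'.const_mul 2),
    lintegral_const_mul' _ _ ENNReal.ofNat_ne_top, lintegral_const_mul' _ _ hSfin,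
    lintegral_const_mul' _ _ (by finiteness), ← lintegral_prod_symm _ hm,
    ← lintegral_prod_symm _ hm', Measure.prod_restrict, Measure.prod_restrict] at fiberwise
  exact fiberwise

end Sobolev

section Foliation

/-- The properties of the cut-off function on which the geometry of the slices depends: it is
continuous, takes values in `[0, 1]`, vanishes on `(-∞, 0]` and equals `1` on `[1, ∞)`. -/
structure IsContinuousCutoff (χ : ℝ → ℝ) : Prop where
  continuous : Continuous χ
  mem_Icc : ∀ x, χ x ∈ Icc (0 : ℝ) 1
  eq_one : ∀ x, 1 ≤ x → χ x = 1
  eq_zero : ∀ x, x ≤ 0 → χ x = 0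

variable {χ aleph : ℝ → ℝ} {s r r₁ r₂ : ℝ} {p : Spacetime}

theorem IsCutoff.isContinuousCutoff (hχ : IsCutoff χ) : IsContinuousCutoff χ where
  continuous := hχ.smooth.continuous
  eq_one := hχ.eq_one
  eq_zero := hχ.eq_zero
  mem_Icc x := by
    rcases le_total x 0 with hx0 | hx0
    · simp [hχ.eq_zero x hx0]
    rcases le_total 1 x with hx1 | hx1
    · simp [hχ.eq_one x hx1]
    have mono : MonotoneOn χ (Icc 0 1) :=
      monotoneOn_of_deriv_nonneg (convex_Icc 0 1) hχ.smooth.continuous.continuousOn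
        (hχ.smooth.differentiable (by simp)).differentiableOn
        fun y hy => (hχ.deriv_pos y (by rwa [interior_Icc] at hy)).le
    have h0 := mono (left_mem_Icc.2 zero_le_one) ⟨hx0, hx1⟩ hx0
    have h1 := mono ⟨hx0, hx1⟩ (right_mem_Icc.2 zero_le_one) hx1
    rw [hχ.eq_zero 0 le_rfl] at h0
    rw [hχ.eq_one 1 le_rfl] at h1
    exact ⟨h0, h1⟩

theorem bracket_pos (ρ : ℝ) : 0 < bracket ρ := Real.sqrt_pos.2 (by positivity)

theorem le_bracket (r : ℝ) : r ≤ bracket r := Real.le_sqrt_of_sq_le (by linarith)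

theorem bracket_le_two_mul (hr : 1 ≤ r) : bracket r ≤ 2 * r :=
  Real.sqrt_le_iff.2 ⟨by linarith, by nlinarith⟩

theorem rhoH_nonneg (hs : 1 ≤ s) : 0 ≤ rhoH s := by unfold rhoH; nlinarith

theorem rhoH_pos (hs : 1 < s) : 0 < rhoH s := by unfold rhoH; nlinarith

theorem three_halves_le_rhoH (hs : 2 ≤ s) : 3 / 2 ≤ rhoH s := by unfold rhoH; nlinarith

theorem xi_mem_Icc (hχ : IsContinuousCutoff χ) (s r : ℝ) : xi χ s r ∈ Icc (0 : ℝ) 1 := by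
  obtain ⟨h0, h1⟩ := hχ.mem_Icc (r - rhoH s)
  constructor <;> unfold xi <;> linarith

theorem xi_eq_zero (hχ : IsContinuousCutoff χ) (hr : rhoH s + 1 ≤ r) : xi χ s r = 0 := by
  rw [xi, hχ.eq_one _ (by linarith), sub_self]

theorem xi_eq_one (hχ : IsContinuousCutoff χ) (hr : r ≤ rhoH s) : xi χ s r = 1 := by
  rw [xi, hχ.eq_zero _ (by linarith), sub_zero]

theorem zeta_eq_one (hχ : IsContinuousCutoff χ) (hr : rhoH s + 1 ≤ r) : zeta χ s r = 1 := by
  simp [zeta, xi_eq_zero hχ hr]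

theorem continuous_slope (hχ : IsContinuousCutoff χ) (hs : 0 < s) : Continuous (slope χ s) := by
  have := hχ.continuous
  unfold slope xi
  exact Continuous.div (by fun_prop) (by fun_prop) fun r => (Real.sqrt_pos.2 (by positivity)).ne'

theorem slope_mem_Icc (hχ : IsContinuousCutoff χ) (hr : 0 ≤ r) : slope χ s r ∈ Icc (0 : ℝ) 1 := by
  obtain ⟨hξ0, hξ1⟩ := xi_mem_Icc hχ s r
  have hle : r ≤ Real.sqrt (s ^ 2 + r ^ 2) := Real.le_sqrt_of_sq_le (by nlinarith [sq_nonneg s])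
  exact ⟨by unfold slope; positivity,
    div_le_one_of_le₀ ((mul_le_of_le_one_left hr hξ1).trans hle) (Real.sqrt_nonneg _)⟩

theorem hasDerivAt_timeFn (hχ : IsContinuousCutoff χ) (hs : 0 < s) (r : ℝ) :
    HasDerivAt (timeFn χ s) (slope χ s r) r :=
  ((continuous_slope hχ hs).integral_hasStrictDerivAt 0 r).hasDerivAt.const_add s

theorem continuous_timeFn (hχ : IsContinuousCutoff χ) (hs : 0 < s) : Continuous (timeFn χ s) :=
  continuous_iff_continuousAt.2 fun r => (hasDerivAt_timeFn hχ hs r).continuousAt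

theorem integral_slope (hχ : IsContinuousCutoff χ) (hs : 0 < s) (r₁ r₂ : ℝ) :
    ∫ ρ in r₁..r₂, slope χ s ρ = timeFn χ s r₂ - timeFn χ s r₁ :=
  intervalIntegral.integral_eq_sub_of_hasDerivAt (fun ρ _ => hasDerivAt_timeFn hχ hs ρ)
    ((continuous_slope hχ hs).intervalIntegrable _ _)

theorem timeFn_sub_mem_Icc (hχ : IsContinuousCutoff χ) (hs : 0 < s) (hr₁ : 0 ≤ r₁)
    (hr : r₁ ≤ r₂) : timeFn χ s r₂ - timeFn χ s r₁ ∈ Icc 0 (r₂ - r₁) := by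
  have slope_mem (ρ) (hρ : ρ ∈ Icc r₁ r₂) : slope χ s ρ ∈ Icc (0 : ℝ) 1 :=
    slope_mem_Icc hχ (hr₁.trans hρ.1)
  rw [← integral_slope hχ hs]
  refine ⟨intervalIntegral.integral_nonneg hr fun ρ hρ => (slope_mem ρ hρ).1, ?_⟩
  simpa using intervalIntegral.integral_mono_on (μ := volume) hr
    ((continuous_slope hχ hs).intervalIntegrable _ _) intervalIntegrable_const
    fun ρ hρ => (slope_mem ρ hρ).2

theorem timeFn_of_le_rhoH (hχ : IsContinuousCutoff χ) (hs : 0 < s) (hr : 0 ≤ r)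
    (hrs : r ≤ rhoH s) : timeFn χ s r = Real.sqrt (s ^ 2 + r ^ 2) := by
  have deriv_hyperbola (ρ) (hρ : ρ ∈ uIcc 0 r) :
      HasDerivAt (fun ρ => Real.sqrt (s ^ 2 + ρ ^ 2)) (slope χ s ρ) ρ := by
    rw [uIcc_of_le hr] at hρ
    have sq : HasDerivAt (fun ρ : ℝ => s ^ 2 + ρ ^ 2) (2 * ρ) ρ := by
      simpa using (hasDerivAt_pow 2 ρ).const_add (s ^ 2)
    refine (sq.sqrt (by positivity)).congr_deriv ?_
    rw [slope, xi_eq_one hχ (hρ.2.trans hrs), one_mul, mul_div_mul_left _ _ two_ne_zero]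
  rw [timeFn, intervalIntegral.integral_eq_sub_of_hasDerivAt deriv_hyperbola
    ((continuous_slope hχ hs).intervalIntegrable _ _), zero_pow two_ne_zero, add_zero,
    Real.sqrt_sq hs.le, add_sub_cancel]

theorem timeFn_rhoH (hχ : IsContinuousCutoff χ) (hs : 1 ≤ s) :
    timeFn χ s (rhoH s) = rhoH s + 1 := by
  have hR := rhoH_nonneg hs
  rw [timeFn_of_le_rhoH hχ (by linarith) hR le_rfl,
    show s ^ 2 + rhoH s ^ 2 = (rhoH s + 1) ^ 2 by unfold rhoH; ring, Real.sqrt_sq (by linarith)]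

theorem timeFn_eq_of_flat (hχ : IsContinuousCutoff χ) (hs : 0 < s) (hr : rhoH s + 1 ≤ r) :
    timeFn χ s r = timeFn χ s (rhoH s + 1) := by
  have slope_zero : EqOn (slope χ s) 0 (uIcc (rhoH s + 1) r) := fun ρ hρ => by
    rw [uIcc_of_le hr] at hρ
    simp [slope, xi_eq_zero hχ hρ.1]
  rw [← sub_eq_zero, ← integral_slope hχ hs, intervalIntegral.integral_congr slope_zero]
  exact intervalIntegral.integral_zero

theorem timeFn_mem_Icc (hχ : IsContinuousCutoff χ) (hs : 1 ≤ s) (hr : rhoH s ≤ r) :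
    timeFn χ s r ∈ Icc (rhoH s + 1) (rhoH s + 2) := by
  have growth (ρ) (hρ : rhoH s ≤ ρ) : timeFn χ s ρ - (rhoH s + 1) ∈ Icc 0 (ρ - rhoH s) := by
    rw [← timeFn_rhoH hχ hs]
    exact timeFn_sub_mem_Icc hχ (by linarith) (rhoH_nonneg hs) hρ
  refine ⟨by linarith [(growth r hr).1], ?_⟩
  rcases le_total r (rhoH s + 1) with hr1 | hr1
  · linarith [(growth r hr).2]
  · rw [timeFn_eq_of_flat hχ (by linarith) hr1]
    linarith [(growth (rhoH s + 1) (by linarith)).2]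

theorem timeFn_le_add_one (hχ : IsContinuousCutoff χ) (hs : 1 ≤ s) (hr : rhoH s ≤ r) :
    timeFn χ s r ≤ r + 1 := by
  have growth := timeFn_sub_mem_Icc hχ (zero_lt_one.trans_le hs) (rhoH_nonneg hs) hr
  rw [timeFn_rhoH hχ hs] at growth
  linarith [growth.2]

theorem weight_eq (hχ : IsContinuousCutoff χ) (ha : ∀ y, 1 ≤ y → aleph y = y + 1) (hs : 1 ≤ s)
    (hr : rhoH s ≤ r) : weight aleph (timeFn χ s r) r = 4 + r - timeFn χ s r := by
  rw [weight, ha _ (by linarith [timeFn_le_add_one hχ hs hr])]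
  ring

theorem three_le_weight (hχ : IsContinuousCutoff χ) (ha : ∀ y, 1 ≤ y → aleph y = y + 1)
    (hs : 1 ≤ s) (hr : rhoH s ≤ r) : 3 ≤ weight aleph (timeFn χ s r) r := by
  rw [weight_eq hχ ha hs hr]
  linarith [timeFn_le_add_one hχ hs hr]

theorem sub_rhoH_add_two_le_weight (hχ : IsContinuousCutoff χ)
    (ha : ∀ y, 1 ≤ y → aleph y = y + 1) (hs : 1 ≤ s) (hr : rhoH s ≤ r) :
    r - rhoH s + 2 ≤ weight aleph (timeFn χ s r) r := by
  rw [weight_eq hχ ha hs hr]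
  linarith [(timeFn_mem_Icc hχ hs hr).2]

theorem weight_mono (hχ : IsContinuousCutoff χ) (ha : ∀ y, 1 ≤ y → aleph y = y + 1) (hs : 1 ≤ s)
    (hr₁ : rhoH s ≤ r₁) (hr : r₁ ≤ r₂) :
    weight aleph (timeFn χ s r₁) r₁ ≤ weight aleph (timeFn χ s r₂) r₂ := by
  have growth := timeFn_sub_mem_Icc hχ (zero_lt_one.trans_le hs) ((rhoH_nonneg hs).trans hr₁) hr
  rw [weight_eq hχ ha hs hr₁, weight_eq hχ ha hs (hr₁.trans hr)]
  linarith [growth.2]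

theorem transBase_union_flatBase (s : ℝ) : transBase s ∪ flatBase s = {x | rhoH s ≤ ‖x‖} := by
  ext x
  simp only [transBase, flatBase, mem_union, mem_ofPred_eq]
  constructor
  · rintro (hx | hx) <;> linarith
  · intro hx
    exact (le_total ‖x‖ (rhoH s + 1)).imp (fun h => ⟨hx, h⟩) id

theorem mem_tpSlice_iff :
    p ∈ tpSlice χ s ↔ rhoH s ≤ ‖p.2‖ ∧ timeFn χ s ‖p.2‖ = p.1 := by
  rw [tpSlice, transSlice, flatSlice, ← image_union, transBase_union_flatBase]
  constructor
  · rintro ⟨x, hx, rfl⟩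
    exact ⟨hx, rfl⟩
  · rintro ⟨hp, ht⟩
    exact ⟨p.2, hp, Prod.ext ht rfl⟩

end Foliation

section Polar

variable {χ : ℝ → ℝ} {s : ℝ} {z : ℝ × ℝ} {p : Spacetime}

/-- The point of the plane with polar coordinates `z = (ρ, θ)`. -/
noncomputable def ofPolar (z : ℝ × ℝ) : Plane := !₂[z.1 * Real.cos z.2, z.1 * Real.sin z.2]

/-- Polar parametrization of the slice of parameter `s`. The time is taken at the radius `z.1`
itself, so that for negative `z.1` the point need not lie on the slice. -/
noncomputable def polarPoint (χ : ℝ → ℝ) (s : ℝ) (z : ℝ × ℝ) : Spacetime :=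
  (timeFn χ s z.1, ofPolar z)

theorem norm_ofPolar (hz : 0 ≤ z.1) : ‖ofPolar z‖ = z.1 := by
  rw [EuclideanSpace.norm_eq, Real.sqrt_eq_iff_mul_self_eq (by positivity) hz]
  simp only [ofPolar, Fin.sum_univ_two, Real.norm_eq_abs, sq_abs, PiLp.toLp_apply,
    Matrix.cons_val_zero, Matrix.cons_val_one]
  linear_combination z.1 ^ 2 * Real.sin_sq_add_cos_sq z.2

theorem exists_ofPolar (x : Plane) : ∃ θ ∈ Icc (-Real.pi) Real.pi, ofPolar (‖x‖, θ) = x := by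
  have norm_complex : ‖(⟨x 0, x 1⟩ : ℂ)‖ = ‖x‖ := by
    simp [EuclideanSpace.norm_eq, Complex.norm_eq_sqrt_sq_add_sq]
  refine ⟨Complex.arg ⟨x 0, x 1⟩, ⟨(Complex.neg_pi_lt_arg _).le, Complex.arg_le_pi _⟩, ?_⟩
  rw [← norm_complex]
  ext i
  fin_cases i
  · exact Complex.norm_mul_cos_arg ⟨x 0, x 1⟩
  · exact Complex.norm_mul_sin_arg ⟨x 0, x 1⟩

theorem continuous_ofPolar : Continuous ofPolar := by
  refine (PiLp.continuous_toLp 2 _).comp (continuous_pi fun i => ?_)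
  fin_cases i
  · change Continuous fun z : ℝ × ℝ => z.1 * Real.cos z.2
    fun_prop
  · change Continuous fun z : ℝ × ℝ => z.1 * Real.sin z.2
    fun_prop

theorem lintegral_eq_lintegral_ofPolar (f : Plane → ℝ≥0∞) :
    ∫⁻ x, f x = ∫⁻ z in Ioi 0 ×ˢ Ioo (-Real.pi) Real.pi, ENNReal.ofReal z.1 * f (ofPolar z) := by
  let e : ℝ × ℝ ≃ᵐ Plane := MeasurableEquiv.finTwoArrow.symm.trans (MeasurableEquiv.toLp 2 _)
  have he : MeasurePreserving e volume volume :=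
    ((volume_preserving_finTwoArrow ℝ).symm _).trans (PiLp.volume_preserving_toLp (Fin 2))
  rw [← he.lintegral_comp_emb e.measurableEmbedding, ← lintegral_comp_polarCoord_symm]
  rfl

theorem slicePoint_ofPolar (hz : 0 ≤ z.1) : slicePoint χ s (ofPolar z) = polarPoint χ s z := by
  rw [slicePoint, norm_ofPolar hz, polarPoint]

theorem polarPoint_mem_tpSlice (hs : 1 ≤ s) (hz : rhoH s ≤ z.1) :
    polarPoint χ s z ∈ tpSlice χ s := by
  have hnorm : ‖(polarPoint χ s z).2‖ = z.1 := norm_ofPolar ((rhoH_nonneg hs).trans hz)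
  rw [mem_tpSlice_iff, hnorm]
  exact ⟨hz, rfl⟩

theorem exists_polarPoint (hp : p ∈ tpSlice χ s) :
    ∃ θ ∈ Icc (-Real.pi) Real.pi, polarPoint χ s (‖p.2‖, θ) = p := by
  obtain ⟨θ, hθ, hx⟩ := exists_ofPolar p.2
  exact ⟨θ, hθ, Prod.ext (mem_tpSlice_iff.1 hp).2 hx⟩

theorem continuous_polarPoint (hχ : IsContinuousCutoff χ) (hs : 0 < s) :
    Continuous (polarPoint χ s) :=
  ((continuous_timeFn hχ hs).comp continuous_fst).prodMk continuous_ofPolar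

end Polar

theorem fderiv_fderiv_clm_apply {E F : Type*} [NormedAddCommGroup E] [NormedSpace ℝ E]
    [NormedAddCommGroup F] [NormedSpace ℝ F] {W : E → F} {p : E} (hW : ContDiffAt ℝ 2 W p)
    (A : E →L[ℝ] E) (e : E) :
    fderiv ℝ (fun q => fderiv ℝ W q (A q)) p e =
      fderiv ℝ (fun q => fderiv ℝ W q e) p (A p) + fderiv ℝ W p (A e) := by
  have diff : DifferentiableAt ℝ (fderiv ℝ W) p :=
    (hW.fderiv_right (m := 1) (by norm_num)).differentiableAt one_ne_zero
  have symm : IsSymmSndFDerivAt ℝ W p := hW.isSymmSndFDerivAt (by simp)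
  rw [fderiv_clm_apply diff A.differentiableAt,
    fderiv_clm_apply diff (differentiableAt_const e)]
  simp [symm e (A p), add_comm]

section VectorFields

variable {χ : ℝ → ℝ} {s r θ : ℝ} {U : Set Spacetime} {v W : Spacetime → ℝ} {p : Spacetime}

theorem fderiv_apply_eq (v : Spacetime → ℝ) (p w : Spacetime) :
    fderiv ℝ v p w = w.1 * dt v p + ∑ a, w.2 a * dx a v p := by
  have decomposition : w = w.1 • ((1, 0) : Spacetime) +
      ∑ a, w.2 a • ((0, EuclideanSpace.single a 1) : Spacetime) := by
    ext i
    · simp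
    · fin_cases i <;> simp
  conv_lhs => rw [decomposition]
  simp only [map_add, map_sum, map_smul, smul_eq_mul, dt, dx]

/-- The direction of the vector field `∂_α`. -/
noncomputable def dir : Fin 3 → Spacetime :=
  Fin.cons (1, 0) fun a => (0, EuclideanSpace.single a 1)

theorem pd_eq (α : Fin 3) (v : Spacetime → ℝ) : pd α v = fun p => fderiv ℝ v p (dir α) := by
  cases α using Fin.cases <;> rfl

/-- The linear vector field `(t, x) ↦ (0, -x², x¹)`, the direction of the rotation `Ω`; its
linearity gives the commutators `[Ω, ∂_α]`. -/
noncomputable def rotGenerator : Spacetime →L[ℝ] Spacetime :=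
  (0 : Spacetime →L[ℝ] ℝ).prod
    ((PiLp.continuousLinearEquiv 2 ℝ fun _ : Fin 2 => ℝ).symm.toContinuousLinearMap ∘L
      ContinuousLinearMap.pi ![-EuclideanSpace.proj 1, EuclideanSpace.proj 0] ∘L
        ContinuousLinearMap.snd ℝ ℝ Plane)

theorem rotGenerator_apply (p : Spacetime) : rotGenerator p = (0, !₂[-p.2 1, p.2 0]) := by
  ext i
  · rfl
  · fin_cases i <;> rfl

theorem rot_eq (v : Spacetime → ℝ) : rot v = fun p => fderiv ℝ v p (rotGenerator p) := by
  funext p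
  simp [rot, fderiv_apply_eq v, rotGenerator_apply]
  ring

theorem rot_pd_sq_le (hW : ContDiffAt ℝ 2 W p) (α : Fin 3) :
    rot (pd α W) p ^ 2 ≤ 2 * pd α (rot W) p ^ 2 + 2 * ∑ a, dx a W p ^ 2 := by
  have commutator : pd α (rot W) p = rot (pd α W) p + fderiv ℝ W p (rotGenerator (dir α)) := by
    rw [pd_eq, pd_eq, rot_eq, rot_eq]
    exact fderiv_fderiv_clm_apply hW rotGenerator (dir α)
  have commutator_sq_le : fderiv ℝ W p (rotGenerator (dir α)) ^ 2 ≤ ∑ a, dx a W p ^ 2 := by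
    rw [fderiv_apply_eq, rotGenerator_apply, Fin.sum_univ_two, Fin.sum_univ_two]
    refine Fin.cases ?_ (fun a => ?_) α
    · simp [dir, add_nonneg, sq_nonneg]
    · simp only [dir, Fin.cons_succ]
      fin_cases a <;> simp [sq_nonneg]
  rw [commutator]
  nlinarith [sq_nonneg (rot (pd α W) p + 2 * fderiv ℝ W p (rotGenerator (dir α)))]

theorem contDiffOn_act (hU : IsOpen U) {m n : ℕ∞ω} (hW : ContDiffOn ℝ n W U) (hmn : m + 1 ≤ n)
    (Z : Field) : ContDiffOn ℝ m (Z.act W) U := by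
  have deriv (e : Spacetime) : ContDiffOn ℝ m (fun p => fderiv ℝ W p e) U :=
    (hW.fderiv_of_isOpen hU hmn).clm_apply contDiffOn_const
  have coord (i : Fin 2) : ContDiffOn ℝ m (fun p : Spacetime => p.2 i) U := by fun_prop
  rcases Z with α | a | _
  · exact (deriv (dir α)).congr fun p _ => congrFun (pd_eq α W) p
  · exact ((coord a).mul (deriv _)).add (contDiff_fst.contDiffOn.mul (deriv _))
  · exact ((coord 0).mul (deriv _)).sub ((coord 1).mul (deriv _))

theorem abs_coord_div_norm_le_one (x : Plane) (a : Fin 2) : |x a / ‖x‖| ≤ 1 := by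
  rw [abs_div, abs_norm]
  exact div_le_one_of_le₀ (PiLp.norm_apply_le x a) (norm_nonneg _)

/-- The derivative along the slice of parameter `s` in the radial direction. -/
noncomputable def radialD (χ : ℝ → ℝ) (s : ℝ) (v : Spacetime → ℝ) (p : Spacetime) : ℝ :=
  ∑ a, p.2 a / ‖p.2‖ * tangD χ s a v p

theorem radialD_eq (χ : ℝ → ℝ) (s : ℝ) (v : Spacetime → ℝ) (p : Spacetime) :
    radialD χ s v p = slope χ s ‖p.2‖ * dt v p + ∑ a, p.2 a / ‖p.2‖ * dx a v p := by
  rcases eq_or_ne p.2 0 with hp | hp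
  · simp [radialD, slope, hp]
  have hn : ‖p.2‖ ≠ 0 := norm_ne_zero_iff.2 hp
  have norm_sq := EuclideanSpace.real_norm_sq_eq p.2
  simp only [radialD, tangD, slope, Fin.sum_univ_two] at norm_sq ⊢
  field_simp
  linear_combination (-xi χ s ‖p.2‖ * dt v p) * norm_sq

theorem radialD_sq_le_density (χ : ℝ → ℝ) (s : ℝ) (v : Spacetime → ℝ) (p : Spacetime) :
    radialD χ s v p ^ 2 ≤ density χ s v p := by
  have unit : ∑ a, (p.2 a / ‖p.2‖) ^ 2 ≤ 1 := by
    simp only [div_pow]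
    rw [← Finset.sum_div, ← EuclideanSpace.real_norm_sq_eq]
    exact div_self_le_one _
  calc radialD χ s v p ^ 2
      ≤ (∑ a, (p.2 a / ‖p.2‖) ^ 2) * ∑ a, tangD χ s a v p ^ 2 :=
        Finset.sum_mul_sq_le_sq_mul_sq _ _ _
    _ ≤ ∑ a, tangD χ s a v p ^ 2 :=
        mul_le_of_le_one_left (Finset.sum_nonneg fun _ _ => sq_nonneg _) unit
    _ ≤ density χ s v p := le_add_of_nonneg_left (sq_nonneg _)

theorem abs_radialD_le (hχ : IsContinuousCutoff χ) (s : ℝ) (v : Spacetime → ℝ) (p : Spacetime) :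
    |radialD χ s v p| ≤ ∑ α, |pd α v p| := by
  have contraction {c : ℝ} (hc : |c| ≤ 1) (y : ℝ) : |c * y| ≤ |y| := by
    rw [abs_mul]; exact mul_le_of_le_one_left (abs_nonneg y) hc
  obtain ⟨hslope0, hslope1⟩ := slope_mem_Icc (s := s) hχ (norm_nonneg p.2)
  rw [radialD_eq, Fin.sum_univ_succ fun α => |pd α v p|]
  refine (abs_add_le _ _).trans (add_le_add (contraction (abs_le.2 ⟨by linarith, hslope1⟩) _) ?_)
  refine (Finset.abs_sum_le_sum_abs _ _).trans (Finset.sum_le_sum fun a _ =>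
    contraction (abs_coord_div_norm_le_one p.2 a) _)

theorem hasDerivAt_radial (hχ : IsContinuousCutoff χ) (hs : 0 < s) (hr : 0 < r)
    (hv : DifferentiableAt ℝ v (polarPoint χ s (r, θ))) :
    HasDerivAt (fun ρ => v (polarPoint χ s (ρ, θ))) (radialD χ s v (polarPoint χ s (r, θ))) r := by
  have curve : HasDerivAt (fun ρ => polarPoint χ s (ρ, θ)) (slope χ s r, ofPolar (1, θ)) r := by
    have ray : (fun ρ => ofPolar (ρ, θ)) = fun ρ => ρ • ofPolar (1, θ) := by
      funext ρ
      ext i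
      fin_cases i <;> simp [ofPolar]
    have := (hasDerivAt_id r).smul_const (ofPolar (1, θ))
    simp only [one_smul, id_eq] at this
    exact (hasDerivAt_timeFn hχ hs r).prodMk (ray ▸ this)
  refine (hv.hasFDerivAt.comp_hasDerivAt r curve).congr_deriv ?_
  have hn : ‖(polarPoint χ s (r, θ)).2‖ = r := norm_ofPolar hr.le
  rw [fderiv_apply_eq, radialD_eq, hn, Fin.sum_univ_two, Fin.sum_univ_two]
  simp [ofPolar, polarPoint, hr.ne']

theorem hasDerivAt_angular (hv : DifferentiableAt ℝ v (polarPoint χ s (r, θ))) :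
    HasDerivAt (fun φ => v (polarPoint χ s (r, φ))) (rot v (polarPoint χ s (r, θ))) θ := by
  have circle : HasDerivAt (fun φ => ![r * Real.cos φ, r * Real.sin φ])
      ![r * -Real.sin θ, r * Real.cos θ] θ := by
    rw [hasDerivAt_pi]
    intro i
    fin_cases i
    · exact (Real.hasDerivAt_cos θ).const_mul r
    · exact (Real.hasDerivAt_sin θ).const_mul r
  have curve : HasDerivAt (fun φ => polarPoint χ s (r, φ))
      (0, !₂[r * -Real.sin θ, r * Real.cos θ]) θ :=
    (hasDerivAt_const θ (timeFn χ s r)).prodMk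
      ((PiLp.continuousLinearEquiv 2 ℝ fun _ : Fin 2 => ℝ).symm.hasFDerivAt.comp_hasDerivAt θ
        circle)
  refine (hv.hasFDerivAt.comp_hasDerivAt θ curve).congr_deriv ?_
  simp [rot_eq, rotGenerator_apply, polarPoint, ofPolar]

theorem continuousOn_radialD (hχ : IsContinuousCutoff χ) (hs : 0 < s) (hU : IsOpen U)
    (hv : ContDiffOn ℝ 1 v U) : ContinuousOn (radialD χ s v) (U ∩ {p | p.2 ≠ 0}) := by
  have deriv (e : Spacetime) : ContinuousOn (fun p => fderiv ℝ v p e) (U ∩ {p | p.2 ≠ 0}) :=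
    ((hv.continuousOn_fderiv_of_isOpen hU le_rfl).mono inter_subset_left).clm_apply
      continuousOn_const
  have slope_cont : Continuous fun p : Spacetime => slope χ s ‖p.2‖ :=
    (continuous_slope hχ hs).comp (by fun_prop)
  rw [funext (radialD_eq χ s v)]
  refine (slope_cont.continuousOn.mul (deriv _)).add (continuousOn_finsetSum _ fun a _ => ?_)
  exact (ContinuousOn.div (by fun_prop) (by fun_prop) fun p hp => norm_ne_zero_iff.2 hp.2).mul
    (deriv _)

theorem density_eq_of_flat (hχ : IsContinuousCutoff χ) (hp : rhoH s + 1 ≤ ‖p.2‖)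
    (v : Spacetime → ℝ) : density χ s v p = ∑ α, pd α v p ^ 2 := by
  simp [density, tangD, zeta_eq_one hχ hp, xi_eq_zero hχ hp, Fin.sum_univ_succ, pd]

theorem pd_sq_le_density_of_flat (hχ : IsContinuousCutoff χ) (hp : rhoH s + 1 ≤ ‖p.2‖)
    (v : Spacetime → ℝ) (α : Fin 3) : pd α v p ^ 2 ≤ density χ s v p := by
  rw [density_eq_of_flat hχ hp]
  exact Finset.single_le_sum (f := fun α => pd α v p ^ 2) (fun _ _ => sq_nonneg _)
    (Finset.mem_univ α)

theorem rot_pd_sq_le_of_flat (hχ : IsContinuousCutoff χ) (hp : rhoH s + 1 ≤ ‖p.2‖)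
    (hW : ContDiffAt ℝ 2 W p) (α : Fin 3) :
    rot (pd α W) p ^ 2 ≤ 2 * pd α (rot W) p ^ 2 + 2 * density χ s W p := by
  have spatial : ∑ a, dx a W p ^ 2 ≤ density χ s W p := by
    rw [density_eq_of_flat hχ hp, Fin.sum_univ_succ]
    exact le_add_of_nonneg_left (sq_nonneg _)
  linarith [rot_pd_sq_le hW α]

end VectorFields

section Energy

variable {χ aleph : ℝ → ℝ} {η s r : ℝ} {p k p' k' : ℕ} {v : Spacetime → ℝ}

/-- The unweighted energy of the part of the slice of parameter `s` lying over the annulus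
`r < |x| < r + 2`, with respect to the measure `dρ dθ` of polar coordinates. -/
noncomputable def annulusEnergy (χ : ℝ → ℝ) (s r : ℝ) (v : Spacetime → ℝ) : ℝ≥0∞ :=
  ∫⁻ z in Ioo r (r + 2) ×ˢ Ioo (-Real.pi) Real.pi,
    ENNReal.ofReal (density χ s v (polarPoint χ s z))

theorem density_nonneg (χ : ℝ → ℝ) (s : ℝ) (v : Spacetime → ℝ) (p : Spacetime) :
    0 ≤ density χ s v p := by
  unfold density; positivity

theorem energyOn_union_le_energyTP (χ aleph : ℝ → ℝ) (η s : ℝ) (v : Spacetime → ℝ) :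
    energyOn χ aleph {x | rhoH s ≤ ‖x‖} η s v ≤ energyTP χ aleph η s v := by
  rw [← transBase_union_flatBase]
  exact lintegral_union_le _ _ _

theorem ofReal_mul_annulusEnergy_le (hχ : IsContinuousCutoff χ)
    (ha : ∀ y, 1 ≤ y → aleph y = y + 1) (hs : 1 ≤ s) (hη : 0 ≤ η) (hr : rhoH s ≤ r)
    (v : Spacetime → ℝ) :
    ENNReal.ofReal (r * weight aleph (timeFn χ s r) r ^ (2 * η)) * annulusEnergy χ s r v ≤
      energyTP χ aleph η s v := by
  have hr0 : 0 ≤ r := (rhoH_nonneg hs).trans hr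
  have hw := three_le_weight hχ ha hs hr
  refine le_trans ?_ (energyOn_union_le_energyTP χ aleph η s v)
  rw [energyOn, ← lintegral_indicator (measurableSet_le measurable_const measurable_norm),
    lintegral_eq_lintegral_ofPolar, annulusEnergy,
    ← lintegral_const_mul' _ _ ENNReal.ofReal_ne_top]
  refine (setLIntegral_mono' (measurableSet_Ioo.prod measurableSet_Ioo) fun z hz => ?_).trans
    (lintegral_mono_set (prod_mono_left fun ρ hρ => hr0.trans_lt hρ.1))
  have hrz : r < z.1 := hz.1.1
  have hz0 : 0 ≤ z.1 := hr0.trans hrz.le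
  have hmem : rhoH s ≤ ‖ofPolar z‖ := by rw [norm_ofPolar hz0]; exact hr.trans hrz.le
  rw [indicator_of_mem (by exact hmem), slicePoint_ofPolar hz0, norm_ofPolar hz0,
    ← ENNReal.ofReal_mul hz0, ← ENNReal.ofReal_mul (by positivity), ← mul_assoc]
  have := density_nonneg χ s v (polarPoint χ s z)
  have weight_le := weight_mono (aleph := aleph) hχ ha hs hr hrz.le
  gcongr

theorem energyTP_compose_le {n : ℕ} (hn : n ≤ p) {Z : Fin n → Field} (hZ : rank Z ≤ k)
    (v : Spacetime → ℝ) :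
    energyTP χ aleph η s (compose Z v) ≤ energyTPOrd χ aleph p k η s v := by
  calc energyTP χ aleph η s (compose Z v)
      = if rank Z ≤ k then energyTP χ aleph η s (compose Z v) else 0 := (if_pos hZ).symm
    _ ≤ ∑ Z : Fin n → Field, if rank Z ≤ k then energyTP χ aleph η s (compose Z v) else 0 :=
        Finset.single_le_sum (f := fun Z : Fin n → Field =>
          if rank Z ≤ k then energyTP χ aleph η s (compose Z v) else 0)
          (fun _ _ => zero_le) (Finset.mem_univ Z)
    _ ≤ energyTPOrd χ aleph p k η s v :=
        Finset.single_le_sum (f := fun n => ∑ Z : Fin n → Field,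
          if rank Z ≤ k then energyTP χ aleph η s (compose Z v) else 0)
          (fun _ _ => zero_le) (Finset.mem_range.2 (Nat.lt_succ_of_le hn))

theorem energyTPOrd_mono (hp : p ≤ p') (hk : k ≤ k') :
    energyTPOrd χ aleph p k η s v ≤ energyTPOrd χ aleph p' k' η s v := by
  refine (Finset.sum_le_sum_of_subset (Finset.range_mono (Nat.succ_le_succ hp))).trans ?_
  refine Finset.sum_le_sum fun n _ => Finset.sum_le_sum fun Z _ => ?_
  split_ifs with h h'
  · exact le_rfl
  · exact absurd (h.trans hk) h'
  all_goals exact zero_le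

theorem compose_snoc {n : ℕ} (Z : Fin n → Field) (z : Field) (v : Spacetime → ℝ) :
    compose (Fin.snoc Z z : Fin (n + 1) → Field) v = compose Z (z.act v) := by
  simp only [compose, List.ofFn_succ', List.concat_eq_append, List.foldr_append, Fin.snoc_castSucc,
    Fin.snoc_last, List.foldr_cons, List.foldr_nil]

theorem rank_snoc_le {n : ℕ} (Z : Fin n → Field) (z : Field) :
    rank (Fin.snoc Z z : Fin (n + 1) → Field) ≤ rank Z + 1 := by
  simp only [rank, Finset.card_filter, Fin.sum_univ_castSucc, Fin.snoc_castSucc, Fin.snoc_last]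
  gcongr
  split_ifs <;> simp

theorem energyTPOrd_act_le (z : Field) :
    energyTPOrd χ aleph p k η s (z.act v) ≤ energyTPOrd χ aleph (p + 1) (k + 1) η s v := by
  have append (n : ℕ) :
      (∑ Z : Fin n → Field,
        if rank Z ≤ k then energyTP χ aleph η s (compose Z (z.act v)) else 0) ≤
        ∑ Z : Fin (n + 1) → Field,
          if rank Z ≤ k + 1 then energyTP χ aleph η s (compose Z v) else 0 := by
    have snoc_injective : Function.Injective fun Z : Fin n → Field =>
        (Fin.snoc Z z : Fin (n + 1) → Field) := Fin.snoc_left_injective (α := fun _ => Field) z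
    refine (Finset.sum_le_sum fun Z _ => ?_).trans (by
      simpa only [tsum_fintype] using ENNReal.tsum_comp_le_tsum_of_injective snoc_injective
        fun Z => if rank Z ≤ k + 1 then energyTP χ aleph η s (compose Z v) else 0)
    rw [compose_snoc]
    split_ifs with h h'
    · exact le_rfl
    · exact absurd ((rank_snoc_le Z z).trans (Nat.succ_le_succ h)) h'
    all_goals exact zero_le
  rw [energyTPOrd, energyTPOrd, Finset.sum_range_succ' _ (p + 1)]
  exact (Finset.sum_le_sum fun n _ => append n).trans (le_add_of_nonneg_right zero_le)

end Energy

section PointwiseBound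

variable {χ aleph : ℝ → ℝ} {s r θ η e : ℝ} {U : Set Spacetime} {v W : Spacetime → ℝ} {z : ℝ × ℝ}

theorem contDiffAt_polarPoint {n : ℕ∞ω} (hs : 1 ≤ s) (hU : IsOpen U) (hsub : tpSlice χ s ⊆ U)
    (hv : ContDiffOn ℝ n v U) (hz : rhoH s ≤ z.1) : ContDiffAt ℝ n v (polarPoint χ s z) :=
  hv.contDiffAt (hU.mem_nhds (hsub (polarPoint_mem_tpSlice hs hz)))

theorem continuousOn_comp_polarPoint (hχ : IsContinuousCutoff χ) (hs : 1 ≤ s)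
    (hv : ContinuousOn v (tpSlice χ s)) :
    ContinuousOn (fun z => v (polarPoint χ s z)) {z | rhoH s ≤ z.1} :=
  hv.comp (continuous_polarPoint hχ (by linarith)).continuousOn fun _ hz =>
    polarPoint_mem_tpSlice hs hz

theorem lintegral_circle_enorm_sq_le (hχ : IsContinuousCutoff χ) (hs : 1 < s) (hr : rhoH s ≤ r)
    (hU : IsOpen U) (hsub : tpSlice χ s ⊆ U) (hv : ContDiffOn ℝ 1 v U) :
    ∫⁻ θ in Ioo (-Real.pi) Real.pi, ‖v (polarPoint χ s (r, θ))‖ₑ ^ 2 ≤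
      2 * (∫⁻ z in Ioo (r + 1) (r + 2) ×ˢ Ioo (-Real.pi) Real.pi, ‖v (polarPoint χ s z)‖ₑ ^ 2) +
        4 * annulusEnergy χ s r v := by
  have hR := rhoH_pos hs
  have hs0 : 0 < s := by linarith
  have strip : Icc r (r + 2) ×ˢ Ioo (-Real.pi) Real.pi ⊆ {z | rhoH s ≤ z.1} :=
    fun z hz => hr.trans hz.1.1
  have away : tpSlice χ s ⊆ U ∩ {p | p.2 ≠ 0} := fun p hp =>
    ⟨hsub hp, norm_pos_iff.1 (hR.trans_le (mem_tpSlice_iff.1 hp).1)⟩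
  have trace := volume_mul_lintegral_enorm_sq_le (S := Ioo (r + 1) (r + 2)) (b := r + 2)
    measurableSet_Ioo measurableSet_Ioo (fun ρ hρ => ⟨by linarith [hρ.1], hρ.2.le⟩)
    (fun θ _ ρ hρ => hasDerivAt_radial hχ hs0 (hR.trans_le (hr.trans hρ.1))
      ((contDiffAt_polarPoint (z := (ρ, θ)) hs.le hU hsub hv (hr.trans hρ.1)).differentiableAt
        one_ne_zero))
    ((continuousOn_comp_polarPoint hχ hs.le (hv.continuousOn.mono hsub)).mono strip)
    ((continuousOn_comp_polarPoint hχ hs.le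
      ((continuousOn_radialD hχ hs0 hU hv).mono away)).mono strip)
    (left_mem_Icc.2 (by linarith))
  norm_num [Real.volume_Ioo, ← mul_assoc] at trace
  refine trace.trans ?_
  rw [annulusEnergy]
  gcongr with z
  rw [enorm_sq_eq_ofReal]
  exact ENNReal.ofReal_le_ofReal (radialD_sq_le_density _ _ _ _)

theorem enorm_sq_le_lintegral_circle (hχ : IsContinuousCutoff χ) (hs : 1 ≤ s) (hr : rhoH s ≤ r)
    (hU : IsOpen U) (hsub : tpSlice χ s ⊆ U) (hv : ContDiffOn ℝ 1 v U)
    (hθ : θ ∈ Icc (-Real.pi) Real.pi) :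
    ‖v (polarPoint χ s (r, θ))‖ₑ ^ 2 ≤
      2 * (∫⁻ φ in Ioo (-Real.pi) Real.pi, ‖v (polarPoint χ s (r, φ))‖ₑ ^ 2) +
        16 * ∫⁻ φ in Ioo (-Real.pi) Real.pi, ‖rot v (polarPoint χ s (r, φ))‖ₑ ^ 2 := by
  have pi_gt := Real.pi_gt_three
  have unit_arc : Ioo (0 : ℝ) 1 ⊆ Ioo (-Real.pi) Real.pi := fun φ hφ =>
    ⟨by linarith [hφ.1], by linarith [hφ.2]⟩
  have rot_cont : ContinuousOn (rot v) (tpSlice χ s) :=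
    (contDiffOn_act (m := 0) hU hv (by simp) (.inr (.inr ()))).continuousOn.mono hsub
  have sobolev := volume_mul_enorm_sq_le measurableSet_Ioo
    (unit_arc.trans Ioo_subset_Icc_self)
    (fun φ _ => hasDerivAt_angular ((contDiffAt_polarPoint (z := (r, φ)) hs hU hsub hv
      hr).differentiableAt one_ne_zero))
    (ContinuousOn.integrableOn_Icc ((continuousOn_comp_polarPoint hχ hs rot_cont).comp
      (by fun_prop) fun φ _ => hr)) hθ
  rw [Real.volume_Ioo, sub_zero, ENNReal.ofReal_one, one_mul, one_mul] at sobolev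
  refine sobolev.trans (add_le_add ?_ ?_)
  · gcongr
  · gcongr
    rw [← ENNReal.ofReal_ofNat 2, ← ENNReal.ofReal_mul zero_le_two, ← ENNReal.ofReal_ofNat 16]
    exact ENNReal.ofReal_le_ofReal (by linarith [Real.pi_lt_four])

theorem rhoH_add_one_le_norm_polarPoint (hs : 1 ≤ s) (hz : rhoH s + 1 ≤ z.1) :
    rhoH s + 1 ≤ ‖(polarPoint χ s z).2‖ :=
  hz.trans_eq (norm_ofPolar (by linarith [rhoH_nonneg hs])).symm

theorem lintegral_pd_sq_le_annulusEnergy (hχ : IsContinuousCutoff χ) (hs : 1 ≤ s)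
    (hr : rhoH s ≤ r) (W : Spacetime → ℝ) (α : Fin 3) :
    ∫⁻ z in Ioo (r + 1) (r + 2) ×ˢ Ioo (-Real.pi) Real.pi, ‖pd α W (polarPoint χ s z)‖ₑ ^ 2 ≤
      annulusEnergy χ s r W := by
  refine (setLIntegral_mono' (measurableSet_Ioo.prod measurableSet_Ioo) fun z hz => ?_).trans
    (lintegral_mono_set (prod_mono_left (Ioo_subset_Ioo_left (by linarith))))
  rw [enorm_sq_eq_ofReal]
  exact ENNReal.ofReal_le_ofReal (pd_sq_le_density_of_flat hχ
    (rhoH_add_one_le_norm_polarPoint hs (by linarith [hz.1.1])) W α)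

theorem lintegral_rot_pd_sq_le_annulusEnergy (hχ : IsContinuousCutoff χ) (hs : 1 ≤ s)
    (hr : rhoH s ≤ r) (hU : IsOpen U) (hsub : tpSlice χ s ⊆ U) (hW : ContDiffOn ℝ 2 W U)
    (α : Fin 3) :
    ∫⁻ z in Ioo (r + 1) (r + 2) ×ˢ Ioo (-Real.pi) Real.pi,
        ‖rot (pd α W) (polarPoint χ s z)‖ₑ ^ 2 ≤
      2 * annulusEnergy χ s r (rot W) + 2 * annulusEnergy χ s r W := by
  set F := Ioo (r + 1) (r + 2) ×ˢ Ioo (-Real.pi) Real.pi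
  have hF : MeasurableSet F := measurableSet_Ioo.prod measurableSet_Ioo
  have flat : ∀ z ∈ F, rhoH s + 1 ≤ z.1 := fun z hz => by linarith [hz.1.1]
  have hrot : ContDiffOn ℝ 1 (rot W) U := contDiffOn_act hU hW (by norm_num) (.inr (.inr ()))
  have hpd : ContinuousOn (pd α (rot W)) (tpSlice χ s) :=
    (contDiffOn_act (m := 0) hU hrot (by simp) (.inl α)).continuousOn.mono hsub
  have meas : AEMeasurable (fun z => ‖pd α (rot W) (polarPoint χ s z)‖ₑ ^ 2)
      (volume.restrict F) :=
    (((continuousOn_comp_polarPoint hχ hs hpd).mono fun z hz =>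
      (lt_add_one _).le.trans (flat z hz)).enorm.aemeasurable hF).pow_const 2
  have pointwise : ∀ z ∈ F, ‖rot (pd α W) (polarPoint χ s z)‖ₑ ^ 2 ≤
      2 * ‖pd α (rot W) (polarPoint χ s z)‖ₑ ^ 2 +
        2 * ENNReal.ofReal (density χ s W (polarPoint χ s z)) := fun z hz => by
    have hW_at := contDiffAt_polarPoint hs hU hsub hW (by linarith [flat z hz])
    rw [enorm_sq_eq_ofReal, enorm_sq_eq_ofReal, ← ENNReal.ofReal_ofNat 2,
      ← ENNReal.ofReal_mul zero_le_two, ← ENNReal.ofReal_mul zero_le_two,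
      ← ENNReal.ofReal_add (by positivity) (mul_nonneg zero_le_two (density_nonneg _ _ _ _))]
    exact ENNReal.ofReal_le_ofReal
      (rot_pd_sq_le_of_flat hχ (rhoH_add_one_le_norm_polarPoint hs (flat z hz)) hW_at α)
  refine (setLIntegral_mono' hF pointwise).trans ?_
  rw [lintegral_add_left' (meas.const_mul 2), lintegral_const_mul' _ _ ENNReal.ofNat_ne_top,
    lintegral_const_mul' _ _ ENNReal.ofNat_ne_top]
  gcongr
  · exact lintegral_pd_sq_le_annulusEnergy hχ hs hr (rot W) α
  · exact lintegral_mono_set (prod_mono_left (Ioo_subset_Ioo_left (by linarith)))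

theorem enorm_sq_pd_le_annulusEnergy (hχ : IsContinuousCutoff χ) (hs : 1 < s) (hr : rhoH s ≤ r)
    (hU : IsOpen U) (hsub : tpSlice χ s ⊆ U) (hW : ContDiffOn ℝ 3 W U)
    (hθ : θ ∈ Icc (-Real.pi) Real.pi) (α : Fin 3) :
    ‖pd α W (polarPoint χ s (r, θ))‖ₑ ^ 2 ≤
      68 * annulusEnergy χ s r W + 64 * annulusEnergy χ s r (rot W) +
        8 * annulusEnergy χ s r (pd α W) + 64 * annulusEnergy χ s r (rot (pd α W)) := by
  have hpd : ContDiffOn ℝ 2 (pd α W) U := contDiffOn_act hU hW (by norm_num) (.inl α)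
  have hrot : ContDiffOn ℝ 1 (rot (pd α W)) U :=
    contDiffOn_act hU hpd (by norm_num) (.inr (.inr ()))
  have hpd₁ := hpd.of_le (m := 1) (by norm_num)
  calc ‖pd α W (polarPoint χ s (r, θ))‖ₑ ^ 2
      ≤ 2 * (∫⁻ φ in Ioo (-Real.pi) Real.pi, ‖pd α W (polarPoint χ s (r, φ))‖ₑ ^ 2) +
        16 * ∫⁻ φ in Ioo (-Real.pi) Real.pi, ‖rot (pd α W) (polarPoint χ s (r, φ))‖ₑ ^ 2 :=
        enorm_sq_le_lintegral_circle hχ hs.le hr hU hsub hpd₁ hθ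
    _ ≤ 2 * (2 * annulusEnergy χ s r W + 4 * annulusEnergy χ s r (pd α W)) +
        16 * (2 * (2 * annulusEnergy χ s r (rot W) + 2 * annulusEnergy χ s r W) +
          4 * annulusEnergy χ s r (rot (pd α W))) := by
        gcongr
        · exact (lintegral_circle_enorm_sq_le hχ hs hr hU hsub hpd₁).trans
            (by gcongr; exact lintegral_pd_sq_le_annulusEnergy hχ hs.le hr W α)
        · exact (lintegral_circle_enorm_sq_le hχ hs hr hU hsub hrot).trans
            (by gcongr; exact lintegral_rot_pd_sq_le_annulusEnergy hχ hs.le hr hU hsub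
                  (hW.of_le (by norm_num)) α)
    _ = _ := by ring

theorem ofReal_mul_pd_sq_le_energyTPOrd (hχ : IsContinuousCutoff χ)
    (ha : ∀ y, 1 ≤ y → aleph y = y + 1) (hs : 1 < s) (hη : 0 ≤ η) (hr : rhoH s ≤ r)
    (hU : IsOpen U) (hsub : tpSlice χ s ⊆ U) (hW : ContDiffOn ℝ 3 W U)
    (hθ : θ ∈ Icc (-Real.pi) Real.pi) (α : Fin 3) :
    ENNReal.ofReal (r * weight aleph (timeFn χ s r) r ^ (2 * η) *
        pd α W (polarPoint χ s (r, θ)) ^ 2) ≤ 204 * energyTPOrd χ aleph 2 1 η s W := by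
  have hr0 : 0 < r := (rhoH_pos hs).trans_le hr
  have hw := three_le_weight hχ ha hs.le hr
  set c := ENNReal.ofReal (r * weight aleph (timeFn χ s r) r ^ (2 * η)) with hc
  have term_le {n : ℕ} (hn : n ≤ 2) {Z : Fin n → Field} (hZ : rank Z ≤ 1) :
      c * annulusEnergy χ s r (compose Z W) ≤ energyTPOrd χ aleph 2 1 η s W :=
    (ofReal_mul_annulusEnergy_le hχ ha hs.le hη hr _).trans (energyTP_compose_le hn hZ W)
  rw [ENNReal.ofReal_mul (by positivity), ← enorm_sq_eq_ofReal, ← hc]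
  calc c * ‖pd α W (polarPoint χ s (r, θ))‖ₑ ^ 2
      ≤ c * (68 * annulusEnergy χ s r W + 64 * annulusEnergy χ s r (rot W) +
          8 * annulusEnergy χ s r (pd α W) + 64 * annulusEnergy χ s r (rot (pd α W))) := by
        gcongr
        exact enorm_sq_pd_le_annulusEnergy hχ hs hr hU hsub hW hθ α
    _ = 68 * (c * annulusEnergy χ s r W) + 64 * (c * annulusEnergy χ s r (rot W)) +
          8 * (c * annulusEnergy χ s r (pd α W)) +
          64 * (c * annulusEnergy χ s r (rot (pd α W))) := by ring
    _ ≤ 68 * energyTPOrd χ aleph 2 1 η s W + 64 * energyTPOrd χ aleph 2 1 η s W +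
          8 * energyTPOrd χ aleph 2 1 η s W + 64 * energyTPOrd χ aleph 2 1 η s W := by
        gcongr
        · exact term_le (Z := ![]) (by decide) (by decide)
        · exact term_le (Z := ![.inr (.inr ())]) (by decide) (by decide)
        · exact term_le (Z := ![.inl α]) (by decide) (Nat.zero_le 1)
        · exact term_le (Z := ![.inr (.inr ()), .inl α]) (by decide) le_rfl
    _ = 204 * energyTPOrd χ aleph 2 1 η s W := by ring

/-- The bound `⟨r⟩^{1/2} ω^η |∂v| ≤ M` on the slice of parameter `s`, needed for both `v = u` and
`v = L_a u`. -/
def GradientDecay (χ aleph : ℝ → ℝ) (η s M : ℝ) (v : Spacetime → ℝ) : Prop :=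
  ∀ p ∈ tpSlice χ s, ∀ α,
    bracket ‖p.2‖ ^ (1 / 2 : ℝ) * weight aleph p.1 ‖p.2‖ ^ η * |pd α v p| ≤ M

theorem gradientDecay_of_energyTPOrd_le (hχ : IsContinuousCutoff χ)
    (ha : ∀ y, 1 ≤ y → aleph y = y + 1) (hs : 2 ≤ s) (hη : 0 ≤ η) (hU : IsOpen U)
    (hsub : tpSlice χ s ⊆ U) (hW : ContDiffOn ℝ 3 W U) (he : 0 ≤ e)
    (hE : energyTPOrd χ aleph 2 1 η s W ≤ ENNReal.ofReal e) :
    GradientDecay χ aleph η s (21 * √e) W := by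
  intro p hp α
  obtain ⟨hr, ht⟩ := mem_tpSlice_iff.1 hp
  obtain ⟨θ, hθ, hpolar⟩ := exists_polarPoint hp
  have hr₁ : 1 ≤ ‖p.2‖ := by linarith [three_halves_le_rhoH hs]
  have hb := bracket_pos ‖p.2‖
  have hb₂ := bracket_le_two_mul hr₁
  have hw := three_le_weight hχ ha (by linarith) hr
  have hsq := (ofReal_mul_pd_sq_le_energyTPOrd hχ ha (by linarith) hη hr hU hsub hW hθ α).trans
    (mul_le_mul_right hE 204)
  rw [← ENNReal.ofReal_ofNat 204, ← ENNReal.ofReal_mul (by norm_num),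
    ENNReal.ofReal_le_ofReal_iff (by positivity), hpolar] at hsq
  rw [ht] at hsq hw
  refine abs_le_of_sq_le_sq' ?_ (by positivity) |>.2
  calc _ = bracket ‖p.2‖ * weight aleph p.1 ‖p.2‖ ^ (2 * η) * pd α W p ^ 2 := by
        rw [mul_pow, mul_pow, sq_abs, ← Real.rpow_mul_natCast hb.le,
          ← Real.rpow_mul_natCast (by linarith), mul_comm η]
        norm_num
    _ ≤ 2 * ‖p.2‖ * weight aleph p.1 ‖p.2‖ ^ (2 * η) * pd α W p ^ 2 := by gcongr
    _ ≤ 441 * e := by linarith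
    _ = (21 * √e) ^ 2 := by rw [mul_pow, Real.sq_sqrt he]; norm_num

theorem GradientDecay.abs_pd_le {M A B : ℝ} {p : Spacetime} (h : GradientDecay χ aleph η s M v)
    (hp : p ∈ tpSlice χ s) (hη : 0 ≤ η) (hA : 0 < A) (hAp : A ≤ bracket ‖p.2‖) (hB : 0 < B)
    (hBp : B ≤ weight aleph p.1 ‖p.2‖) (α : Fin 3) :
    |pd α v p| ≤ M * A ^ (-(1 / 2) : ℝ) * B ^ (-η) := by
  rw [Real.rpow_neg hA.le, Real.rpow_neg hB.le, ← div_eq_mul_inv, ← div_eq_mul_inv, div_div,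
    le_div_iff₀ (by positivity), mul_comm]
  refine le_trans ?_ (h p hp α)
  have := hA.trans_le hAp
  gcongr

end PointwiseBound

section NullDerivative

theorem rpow_le_rpow_mul_rpow {b c x y m : ℝ} (hb : 0 ≤ b) (hbx : b ≤ c * x) (hc : 1 ≤ c)
    (hx : 0 ≤ x) (hy : 0 ≤ y) (hym : y ≤ m) : b ^ y ≤ c ^ m * x ^ y := by
  calc b ^ y ≤ (c * x) ^ y := Real.rpow_le_rpow hb hbx hy
    _ = c ^ y * x ^ y := Real.mul_rpow (by linarith) hx
    _ ≤ c ^ m * x ^ y := by gcongr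

theorem norm_sub_le_of_norm_deriv_le_rpow {E : Type*} [NormedAddCommGroup E] [NormedSpace ℝ E]
    {f f' : ℝ → E} {a b c k η : ℝ} (hca : c < a) (hab : a ≤ b) (hη : η < 1)
    (hf : ∀ x ∈ Icc a b, HasDerivAt f (f' x) x)
    (hf' : ∀ x ∈ Icc a b, ‖f' x‖ ≤ k * (x - c) ^ (-η)) :
    ‖f b - f a‖ ≤ k * (b - c) ^ (1 - η) / (1 - η) := by
  have hη' : 0 < 1 - η := by linarith
  have hk : 0 ≤ k := nonneg_of_mul_nonneg_left
    ((norm_nonneg _).trans (hf' a (left_mem_Icc.2 hab))) (Real.rpow_pos_of_pos (by linarith) _)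
  let B : ℝ → ℝ := fun x => k * (x - c) ^ (1 - η) / (1 - η)
  have hB (x) (hx : x ∈ Icc a b) : HasDerivAt B (k * (x - c) ^ (-η)) x := by
    have hpow := ((hasDerivAt_id x).sub_const c).rpow_const (p := 1 - η)
      (Or.inl (by simp only [id]; linarith [hx.1]))
    refine ((hpow.const_mul k).div_const (1 - η)).congr_deriv ?_
    rw [show 1 - η - 1 = -η by ring, id]
    field_simp
  have hBa : 0 ≤ B a := by have := sub_pos.2 hca; positivity
  have integrated := image_norm_le_of_norm_deriv_right_le_deriv_boundary'
    (f := fun x => f x - f a) (f' := f') (B := fun x => B x - B a)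
    (B' := fun x => k * (x - c) ^ (-η))
    (fun x hx => ((hf x hx).sub_const _).continuousAt.continuousWithinAt)
    (fun x hx => ((hf x (Ico_subset_Icc_self hx)).sub_const _).hasDerivWithinAt) (by simp)
    (fun x hx => ((hB x hx).sub_const _).continuousAt.continuousWithinAt)
    (fun x hx => ((hB x (Ico_subset_Icc_self hx)).sub_const _).hasDerivWithinAt)
    (fun x hx => hf' x (Ico_subset_Icc_self hx)) (right_mem_Icc.2 hab)
  exact integrated.trans (sub_le_self _ hBa)

variable {χ aleph : ℝ → ℝ} {s η M K : ℝ} {U : Set Spacetime} {u v : Spacetime → ℝ}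
  {p : Spacetime} {a : Fin 2}

theorem GradientDecay.nonneg (hχ : IsContinuousCutoff χ) (ha : ∀ y, 1 ≤ y → aleph y = y + 1)
    (hs : 1 ≤ s) (hv : GradientDecay χ aleph η s M v) (hp : p ∈ tpSlice χ s) : 0 ≤ M := by
  obtain ⟨hr, ht⟩ := mem_tpSlice_iff.1 hp
  have hw := ht ▸ three_le_weight hχ ha hs hr
  have hb := bracket_pos ‖p.2‖
  exact le_trans (by positivity) (hv p hp 0)

theorem abs_radialD_le_of_gradientDecay (hχ : IsContinuousCutoff χ)
    (ha : ∀ y, 1 ≤ y → aleph y = y + 1) (hs : 1 < s) (hη : 0 ≤ η)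
    (hv : GradientDecay χ aleph η s M v) (hp : p ∈ tpSlice χ s) :
    |radialD χ s v p| ≤ 3 * M * rhoH s ^ (-(1 / 2) : ℝ) * (‖p.2‖ - (rhoH s - 2)) ^ (-η) := by
  obtain ⟨hr, ht⟩ := mem_tpSlice_iff.1 hp
  have hw := ht ▸ sub_rhoH_add_two_le_weight hχ ha hs.le hr
  calc |radialD χ s v p| ≤ ∑ α, |pd α v p| := abs_radialD_le hχ s v p
    _ ≤ ∑ _α : Fin 3, M * rhoH s ^ (-(1 / 2) : ℝ) * (‖p.2‖ - (rhoH s - 2)) ^ (-η) :=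
        Finset.sum_le_sum fun α _ => hv.abs_pd_le hp hη (rhoH_pos hs) (hr.trans (le_bracket _))
          (by linarith) (by linarith) α
    _ = _ := by simp; ring

theorem abs_boost_le_of_norm_eq (hχ : IsContinuousCutoff χ) (ha : ∀ y, 1 ≤ y → aleph y = y + 1)
    (hs : 2 ≤ s) (hη : 0 ≤ η) (hu : GradientDecay χ aleph η s M u) (hp : p ∈ tpSlice χ s)
    (hpr : ‖p.2‖ = 2 * rhoH s + 2) (a : Fin 2) :
    |boost a u p| ≤ 6 * M * rhoH s ^ (1 / 2 - η) := by
  have hR := three_halves_le_rhoH hs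
  obtain ⟨hr, ht⟩ := mem_tpSlice_iff.1 hp
  have hM := hu.nonneg hχ ha (by linarith) hp
  have hT := ht ▸ timeFn_mem_Icc hχ (by linarith) hr
  have hw := ht ▸ sub_rhoH_add_two_le_weight hχ ha (by linarith) hr
  have hx : |p.2 a| ≤ 2 * rhoH s + 2 := hpr ▸ PiLp.norm_apply_le p.2 a
  have ht_abs : |p.1| ≤ rhoH s + 2 := abs_le.2 ⟨by linarith [hT.1], hT.2⟩
  set D := M * rhoH s ^ (-(1 / 2) : ℝ) * rhoH s ^ (-η) with hD
  have hpd (α) : |pd α u p| ≤ D := hu.abs_pd_le hp hη (by linarith)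
    (hr.trans (le_bracket _)) (by linarith) (by linarith) α
  have hdt : |dt u p| ≤ D := hpd 0
  have hdx : |dx a u p| ≤ D := hpd a.succ
  calc |boost a u p| ≤ |p.2 a| * |dt u p| + |p.1| * |dx a u p| := by
        rw [← abs_mul, ← abs_mul]; exact abs_add_le _ _
    _ ≤ (2 * rhoH s + 2) * D + (rhoH s + 2) * D := by gcongr
    _ = (3 * rhoH s + 4) * D := by ring
    _ ≤ (6 * rhoH s) * D := by gcongr; linarith
    _ = 6 * M * (rhoH s ^ (1 : ℝ) * rhoH s ^ (-(1 / 2) : ℝ) * rhoH s ^ (-η)) := by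
        rw [hD, Real.rpow_one]; ring
    _ = 6 * M * rhoH s ^ (1 / 2 - η) := by
        rw [← Real.rpow_add (by linarith), ← Real.rpow_add (by linarith)]; ring_nf

theorem abs_sub_le_of_gradientDecay {r₁ r₂ : ℝ} (hχ : IsContinuousCutoff χ)
    (ha : ∀ y, 1 ≤ y → aleph y = y + 1) (hs : 1 < s) (hη : 0 ≤ η) (hη1 : η < 1) (hU : IsOpen U)
    (hsub : tpSlice χ s ⊆ U) (hv_smooth : ContDiffOn ℝ 1 v U)
    (hv : GradientDecay χ aleph η s M v) (hr₁ : rhoH s ≤ r₁) (hr : r₁ ≤ r₂) (θ : ℝ) :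
    |v (polarPoint χ s (r₂, θ)) - v (polarPoint χ s (r₁, θ))| ≤
      3 * M * rhoH s ^ (-(1 / 2) : ℝ) * (r₂ - (rhoH s - 2)) ^ (1 - η) / (1 - η) := by
  have hR := rhoH_pos hs
  refine norm_sub_le_of_norm_deriv_le_rpow (f := fun ρ => v (polarPoint χ s (ρ, θ)))
    (f' := fun ρ => radialD χ s v (polarPoint χ s (ρ, θ))) (by linarith) hr hη1
    (fun ρ hρ => ?_) fun ρ hρ => ?_
  · exact hasDerivAt_radial hχ (by linarith) (by linarith [hρ.1]) ((contDiffAt_polarPoint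
      hs.le hU hsub hv_smooth (hr₁.trans hρ.1)).differentiableAt one_ne_zero)
  · have bound := abs_radialD_le_of_gradientDecay hχ ha hs hη hv
      (polarPoint_mem_tpSlice (z := (ρ, θ)) hs.le (hr₁.trans hρ.1))
    rwa [show ‖(polarPoint χ s (ρ, θ)).2‖ = ρ from norm_ofPolar (by linarith [hρ.1])] at bound

theorem abs_boost_le (hχ : IsContinuousCutoff χ) (ha : ∀ y, 1 ≤ y → aleph y = y + 1)
    (hs : 2 ≤ s) (hη : 0 ≤ η) (hη1 : η < 1) (hU : IsOpen U) (hsub : tpSlice χ s ⊆ U)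
    (hLu_smooth : ContDiffOn ℝ 1 (boost a u) U) (hu : GradientDecay χ aleph η s M u)
    (hLu : GradientDecay χ aleph η s M (boost a u)) (hp : p ∈ tpSlice χ s)
    (hpr : ‖p.2‖ ≤ 2 * rhoH s + 2) :
    |boost a u p| ≤ 18 * M * rhoH s ^ (1 / 2 - η) / (1 - η) := by
  have hR := three_halves_le_rhoH hs
  have hM := hu.nonneg hχ ha (by linarith) hp
  have hη' : 0 < 1 - η := by linarith
  obtain ⟨θ, -, hpolar⟩ := exists_polarPoint hp
  set q := polarPoint χ s (2 * rhoH s + 2, θ) with hq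
  have outer : |boost a u q| ≤ 6 * M * rhoH s ^ (1 / 2 - η) :=
    abs_boost_le_of_norm_eq hχ ha hs hη hu
      (polarPoint_mem_tpSlice (z := (2 * rhoH s + 2, θ)) (by linarith) (by linarith))
      (norm_ofPolar (by linarith)) a
  have inward := abs_sub_le_of_gradientDecay hχ ha (by linarith) hη hη1 hU hsub hLu_smooth hLu
    (mem_tpSlice_iff.1 hp).1 hpr θ
  rw [hpolar, ← hq, abs_sub_comm] at inward
  have length_le : (2 * rhoH s + 2 - (rhoH s - 2)) ^ (1 - η) ≤ 4 * rhoH s ^ (1 - η) :=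
    (rpow_le_rpow_mul_rpow (c := 4) (x := rhoH s) (m := 1) (by linarith) (by linarith)
      (by norm_num) (by linarith) hη'.le (by linarith)).trans_eq (by norm_num)
  have hpow : rhoH s ^ (-(1 / 2) : ℝ) * rhoH s ^ (1 - η) = rhoH s ^ (1 / 2 - η) := by
    rw [← Real.rpow_add (by linarith)]; ring_nf
  calc |boost a u p| ≤ |boost a u q| + |boost a u p - boost a u q| := by
        linarith [abs_sub_abs_le_abs_sub (boost a u p) (boost a u q)]
    _ ≤ 6 * M * rhoH s ^ (1 / 2 - η) / (1 - η) +
          3 * M * rhoH s ^ (-(1 / 2) : ℝ) * (4 * rhoH s ^ (1 - η)) / (1 - η) := by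
        refine add_le_add (outer.trans (le_div_self (by positivity) hη' (by linarith))) ?_
        exact inward.trans (by gcongr)
    _ = 18 * M * rhoH s ^ (1 / 2 - η) / (1 - η) := by rw [← hpow]; ring

theorem nullD_eq (a : Fin 2) (u : Spacetime → ℝ) (ht : p.1 ≠ 0) (hp : p.2 ≠ 0) :
    nullD a u p = boost a u p / p.1 + p.2 a / ‖p.2‖ * ((p.1 - ‖p.2‖) / p.1) * dt u p := by
  have := norm_ne_zero_iff.2 hp
  unfold nullD boost
  field_simp
  ring

theorem abs_nullD_le (a : Fin 2) (u : Spacetime → ℝ) (p : Spacetime) :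
    |nullD a u p| ≤ |dt u p| + |dx a u p| := by
  refine (abs_add_le _ _).trans (add_le_add_left ?_ _)
  rw [abs_mul]
  exact mul_le_of_le_one_left (abs_nonneg _) (abs_coord_div_norm_le_one _ _)

theorem abs_nullD_le_boost (hχ : IsContinuousCutoff χ) (ha : ∀ y, 1 ≤ y → aleph y = y + 1)
    (hs : 1 < s) (hp : p ∈ tpSlice χ s) (a : Fin 2) (u : Spacetime → ℝ) :
    |nullD a u p| ≤ |boost a u p| / rhoH s + weight aleph p.1 ‖p.2‖ / rhoH s * |dt u p| := by
  have hR := rhoH_pos hs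
  obtain ⟨hr, ht⟩ := mem_tpSlice_iff.1 hp
  have hT := ht ▸ timeFn_mem_Icc hχ hs.le hr
  have hweight := ht ▸ weight_eq hχ ha hs.le hr
  have hT_le := ht ▸ timeFn_le_add_one hχ hs.le hr
  have ht0 : 0 < p.1 := by linarith [hT.1]
  have hRt : rhoH s ≤ p.1 := by linarith [hT.1]
  have hsub : |p.1 - ‖p.2‖| ≤ weight aleph p.1 ‖p.2‖ := abs_le.2 ⟨by linarith, by linarith⟩
  rw [nullD_eq a u ht0.ne' (norm_pos_iff.1 (hR.trans_le hr))]
  refine (abs_add_le _ _).trans ?_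
  rw [abs_mul, abs_mul, abs_div, abs_div (p.1 - _), abs_of_pos ht0]
  gcongr
  exact (mul_le_of_le_one_left (by positivity) (abs_coord_div_norm_le_one _ _)).trans
    (div_le_div₀ ((abs_nonneg _).trans hsub) hsub hR hRt)

theorem rpow_mul_div_le_of_le_mul_rpow {b R K L : ℝ} (hb : 0 < b) (hbR : b ≤ 8 * R)
    (hη : 0 ≤ η) (hη1 : η ≤ 1) (hL0 : 0 ≤ L) (hL : L ≤ K * R ^ (1 / 2 - η)) :
    b ^ (1 / 2 + η) * (L / R) ≤ 64 * K := by
  have hR : 0 < R := by linarith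
  have hb_pow : b ^ (1 / 2 + η) ≤ 64 * R ^ (1 / 2 + η) :=
    (rpow_le_rpow_mul_rpow (m := 2) hb.le hbR (by norm_num) hR.le (by linarith)
      (by linarith)).trans_eq (by norm_num)
  have hpow : R ^ (1 / 2 + η) * R ^ (1 / 2 - η) = R := by
    rw [← Real.rpow_add hR]; norm_num
  calc b ^ (1 / 2 + η) * (L / R)
      ≤ 64 * R ^ (1 / 2 + η) * (K * R ^ (1 / 2 - η) / R) := by gcongr
    _ = 64 * K * (R ^ (1 / 2 + η) * R ^ (1 / 2 - η) / R) := by ring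
    _ = 64 * K := by rw [hpow, div_self hR.ne', mul_one]

theorem rpow_mul_div_mul_le_of_rpow_mul_le {b w R D : ℝ} (hb : 0 < b) (hbR : b ≤ 8 * R)
    (hw : 0 < w) (hwR : w ≤ 8 * R) (hη : 0 ≤ η) (hη1 : η ≤ 1) (hD : 0 ≤ D)
    (h : b ^ (1 / 2 : ℝ) * w ^ η * D ≤ M) : b ^ (1 / 2 + η) * (w / R * D) ≤ 8 * M := by
  have hR : 0 < R := by linarith
  have hM : 0 ≤ M := le_trans (by positivity) h
  have : 0 ≤ 1 - η := by linarith
  have hbw : b ^ η * w ^ (1 - η) ≤ 8 * R := by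
    calc b ^ η * w ^ (1 - η) ≤ (8 * R) ^ η * (8 * R) ^ (1 - η) := by gcongr
      _ = 8 * R := by rw [← Real.rpow_add (by positivity)]; norm_num
  have hw_split : w = w ^ η * w ^ (1 - η) := by rw [← Real.rpow_add hw]; norm_num
  calc b ^ (1 / 2 + η) * (w / R * D)
      = b ^ (1 / 2 : ℝ) * w ^ η * D * (b ^ η * w ^ (1 - η) / R) := by
        rw [Real.rpow_add hb]; nth_rw 1 [hw_split]; ring
    _ ≤ M * (8 * R / R) := by gcongr
    _ = 8 * M := by field_simp

theorem bracket_rpow_mul_abs_nullD_le_near (hχ : IsContinuousCutoff χ)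
    (ha : ∀ y, 1 ≤ y → aleph y = y + 1) (hs : 2 ≤ s) (hη : 0 ≤ η) (hη1 : η ≤ 1)
    (hu : GradientDecay χ aleph η s M u) (hp : p ∈ tpSlice χ s) (hpr : ‖p.2‖ ≤ 2 * rhoH s + 2)
    (hL : |boost a u p| ≤ K * rhoH s ^ (1 / 2 - η)) :
    bracket ‖p.2‖ ^ (1 / 2 + η) * |nullD a u p| ≤ 64 * K + 8 * M := by
  have hR := three_halves_le_rhoH hs
  obtain ⟨hr, ht⟩ := mem_tpSlice_iff.1 hp
  have hT := ht ▸ timeFn_mem_Icc hχ (by linarith) hr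
  have hweight := ht ▸ weight_eq hχ ha (by linarith) hr
  have hw := ht ▸ three_le_weight hχ ha (by linarith) hr
  have hwR : weight aleph p.1 ‖p.2‖ ≤ 8 * rhoH s := by linarith [hT.1]
  have hb := bracket_pos ‖p.2‖
  have hbR : bracket ‖p.2‖ ≤ 8 * rhoH s := by
    linarith [bracket_le_two_mul (r := ‖p.2‖) (by linarith)]
  have boost_part := rpow_mul_div_le_of_le_mul_rpow hb hbR hη hη1 (abs_nonneg _) hL
  have dt_part := rpow_mul_div_mul_le_of_rpow_mul_le hb hbR (by linarith) hwR hη hη1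
    (abs_nonneg (dt u p)) (hu p hp 0)
  calc bracket ‖p.2‖ ^ (1 / 2 + η) * |nullD a u p|
      ≤ bracket ‖p.2‖ ^ (1 / 2 + η) *
          (|boost a u p| / rhoH s + weight aleph p.1 ‖p.2‖ / rhoH s * |dt u p|) := by
        gcongr
        exact abs_nullD_le_boost hχ ha (by linarith) hp a u
    _ ≤ 64 * K + 8 * M := by rw [mul_add]; exact add_le_add boost_part dt_part

theorem bracket_rpow_mul_abs_nullD_le_far (hχ : IsContinuousCutoff χ)
    (ha : ∀ y, 1 ≤ y → aleph y = y + 1) (hs : 2 ≤ s) (hη : 0 ≤ η) (hη1 : η ≤ 1)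
    (hu : GradientDecay χ aleph η s M u) (hp : p ∈ tpSlice χ s) (hpr : 2 * rhoH s + 2 ≤ ‖p.2‖)
    (a : Fin 2) :
    bracket ‖p.2‖ ^ (1 / 2 + η) * |nullD a u p| ≤ 8 * M := by
  have hR := three_halves_le_rhoH hs
  obtain ⟨hr, ht⟩ := mem_tpSlice_iff.1 hp
  have hw := ht ▸ sub_rhoH_add_two_le_weight hχ ha (by linarith) hr
  have hb := bracket_pos ‖p.2‖
  have hbw : bracket ‖p.2‖ ≤ 4 * weight aleph p.1 ‖p.2‖ := by
    linarith [bracket_le_two_mul (r := ‖p.2‖) (by linarith)]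
  have hdt : bracket ‖p.2‖ ^ (1 / 2 : ℝ) * weight aleph p.1 ‖p.2‖ ^ η * |dt u p| ≤ M := hu p hp 0
  have hdx : bracket ‖p.2‖ ^ (1 / 2 : ℝ) * weight aleph p.1 ‖p.2‖ ^ η * |dx a u p| ≤ M :=
    hu p hp a.succ
  generalize bracket ‖p.2‖ = b at *
  generalize weight aleph p.1 ‖p.2‖ = w at *
  have hb_pow : b ^ η ≤ 4 * w ^ η :=
    (rpow_le_rpow_mul_rpow hb.le hbw (by norm_num) (by linarith) hη hη1).trans_eq (by norm_num)
  calc b ^ (1 / 2 + η) * |nullD a u p|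
      ≤ b ^ (1 / 2 : ℝ) * (4 * w ^ η) * (|dt u p| + |dx a u p|) := by
        have hw0 : 0 < w := by linarith
        rw [Real.rpow_add hb]
        gcongr
        exact abs_nullD_le a u p
    _ = 4 * (b ^ (1 / 2 : ℝ) * w ^ η * |dt u p| + b ^ (1 / 2 : ℝ) * w ^ η * |dx a u p|) := by
        ring
    _ ≤ 8 * M := by linarith

theorem bracket_rpow_mul_abs_nullD_le (hχ : IsContinuousCutoff χ)
    (ha : ∀ y, 1 ≤ y → aleph y = y + 1) (hs : 2 ≤ s) (hη : 0 ≤ η) (hη1 : η < 1) (hU : IsOpen U)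
    (hsub : tpSlice χ s ⊆ U) (hLu_smooth : ContDiffOn ℝ 1 (boost a u) U)
    (hu : GradientDecay χ aleph η s M u) (hLu : GradientDecay χ aleph η s M (boost a u))
    (hp : p ∈ tpSlice χ s) :
    bracket ‖p.2‖ ^ (1 / 2 + η) * |nullD a u p| ≤ 1160 * M / (1 - η) := by
  have hη' : 0 < 1 - η := by linarith
  have hM := hu.nonneg hχ ha (by linarith) hp
  have hM_le : M ≤ M / (1 - η) := le_div_self hM hη' (by linarith)
  have : 1160 * M / (1 - η) = 1160 * (M / (1 - η)) := mul_div_assoc _ _ _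
  rcases le_total ‖p.2‖ (2 * rhoH s + 2) with hpr | hpr
  · have hL := abs_boost_le hχ ha hs hη hη1 hU hsub hLu_smooth hu hLu hp hpr
    have near := bracket_rpow_mul_abs_nullD_le_near (K := 18 * (M / (1 - η))) hχ ha hs hη hη1.le
      hu hp hpr (hL.trans_eq (by ring))
    linarith
  · linarith [bracket_rpow_mul_abs_nullD_le_far hχ ha hs hη hη1.le hu hp hpr a]

end NullDerivative

theorem bracket_mul_pd_add_bracket_mul_nullD_le {χ aleph : ℝ → ℝ} {s η e : ℝ} {U : Set Spacetime}
    {u : Spacetime → ℝ} {p : Spacetime} (hχ : IsContinuousCutoff χ)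
    (ha : ∀ y, 1 ≤ y → aleph y = y + 1) (hs : 2 ≤ s) (hη : 0 ≤ η) (hη1 : η < 1) (hU : IsOpen U)
    (hsub : tpSlice χ s ⊆ U) (hu : ContDiffOn ℝ 4 u U) (he : 0 ≤ e)
    (hE : energyTPOrd χ aleph 3 2 η s u ≤ ENNReal.ofReal e) (hp : p ∈ tpSlice χ s) (α : Fin 3)
    (a : Fin 2) :
    bracket ‖p.2‖ ^ (1 / 2 : ℝ) * weight aleph p.1 ‖p.2‖ ^ η * |pd α u p| +
        bracket ‖p.2‖ ^ (1 / 2 + η) * |nullD a u p| ≤ 24381 * (1 - η)⁻¹ * √e := by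
  have hLu : ContDiffOn ℝ 3 (boost a u) U :=
    contDiffOn_act hU hu (by norm_num) (.inr (.inl a))
  have decay_u : GradientDecay χ aleph η s (21 * √e) u :=
    gradientDecay_of_energyTPOrd_le hχ ha hs hη hU hsub (hu.of_le (by norm_num)) he
      ((energyTPOrd_mono (by norm_num) (by norm_num)).trans hE)
  have decay_Lu : GradientDecay χ aleph η s (21 * √e) (boost a u) :=
    gradientDecay_of_energyTPOrd_le hχ ha hs hη hU hsub hLu he
      ((energyTPOrd_act_le (.inr (.inl a))).trans hE)
  have null_bound := bracket_rpow_mul_abs_nullD_le hχ ha hs hη hη1 hU hsub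
    (hLu.of_le (by norm_num)) decay_u decay_Lu hp
  have absorb : 21 * √e ≤ 21 * √e / (1 - η) :=
    le_div_self (by positivity) (by linarith) (by linarith)
  calc _ ≤ 21 * √e / (1 - η) + 1160 * (21 * √e) / (1 - η) :=
        add_le_add ((decay_u p hp α).trans absorb) null_bound
    _ = 24381 * (1 - η)⁻¹ * √e := by ring

end EuclHyp

theorem mainTheorem7_general {χ aleph : ℝ → ℝ} {s η : ℝ} {U : Set EuclHyp.Spacetime}
    {u : EuclHyp.Spacetime → ℝ} {p : EuclHyp.Spacetime} (hχ : EuclHyp.IsContinuousCutoff χ)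
    (ha : ∀ y, 1 ≤ y → aleph y = y + 1) (hs : 2 ≤ s) (hη : 0 ≤ η) (hη1 : η < 1) (hU : IsOpen U)
    (hsub : EuclHyp.tpSlice χ s ⊆ U) (hu : ContDiffOn ℝ 4 u U) (hp : p ∈ EuclHyp.tpSlice χ s)
    (α : Fin 3) (a : Fin 2) :
    ENNReal.ofReal
        (EuclHyp.bracket ‖p.2‖ ^ (1 / 2 : ℝ) * EuclHyp.weight aleph p.1 ‖p.2‖ ^ η
            * |EuclHyp.pd α u p|
          + EuclHyp.bracket ‖p.2‖ ^ (1 / 2 + η) * |EuclHyp.nullD a u p|)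
      ≤ ENNReal.ofReal (24381 * (1 - η)⁻¹)
        * EuclHyp.energyTPOrd χ aleph 3 2 η s u ^ (1 / 2 : ℝ) := by
  have hC : 0 ≤ 24381 * (1 - η)⁻¹ := mul_nonneg (by norm_num) (inv_nonneg.2 (by linarith))
  obtain hE | hE := eq_or_ne (EuclHyp.energyTPOrd χ aleph 3 2 η s u) ⊤
  · rw [hE, ENNReal.top_rpow_of_pos one_half_pos, ENNReal.mul_top (by simpa using hη1)]
    exact le_top
  · have bound := EuclHyp.bracket_mul_pd_add_bracket_mul_nullD_le hχ ha hs hη hη1 hU hsub hu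
      ENNReal.toReal_nonneg (ENNReal.ofReal_toReal hE).ge hp α a
    rw [Real.sqrt_eq_rpow] at bound
    rw [← ENNReal.ofReal_toReal hE, ENNReal.ofReal_rpow_of_nonneg ENNReal.toReal_nonneg (by simp),
      ← ENNReal.ofReal_mul hC]
    exact ENNReal.ofReal_le_ofReal bound

theorem mainTheorem7 (χ : ℝ → ℝ) (hχ : EuclHyp.IsCutoff χ) :
    ∃ C : ℝ, 0 < C ∧
      ∀ (aleph : ℝ → ℝ), EuclHyp.IsWeightProfile aleph →
      ∀ (s₀ s₁ : ℝ), 2 ≤ s₀ → s₀ ≤ s₁ →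
      ∀ (U : Set EuclHyp.Spacetime), IsOpen U → EuclHyp.tpRegion χ s₀ s₁ ⊆ U →
      ∀ (u : EuclHyp.Spacetime → ℝ), ContDiffOn ℝ 4 u U →
      ∀ (η : ℝ), 0 < η → η < 1 →
      ∀ (s : ℝ), s ∈ Set.Icc s₀ s₁ →
      ∀ (p : EuclHyp.Spacetime), p ∈ EuclHyp.tpSlice χ s →
      ∀ (α : Fin 3) (a : Fin 2),
        ENNReal.ofReal
          (EuclHyp.bracket ‖p.2‖ ^ (1 / 2 : ℝ) * EuclHyp.weight aleph p.1 ‖p.2‖ ^ η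
              * |EuclHyp.pd α u p|
            + EuclHyp.bracket ‖p.2‖ ^ (1 / 2 + η) * |EuclHyp.nullD a u p|)
          ≤ ENNReal.ofReal (C * (1 - η)⁻¹)
            * EuclHyp.energyTPOrd χ aleph 3 3 η s u ^ (1 / 2 : ℝ) := by
  refine ⟨24381, by norm_num, ?_⟩
  intro aleph ha s₀ s₁ hs₀ _ U hU hreg u hu η hη hη1 s hs p hp α a
  refine (mainTheorem7_general hχ.isContinuousCutoff ha.eq_add_one (hs₀.trans hs.1) hη.le hη1 hU
    ((subset_biUnion_of_mem (u := EuclHyp.tpSlice χ) hs).trans hreg) hu hp α a).trans ?_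
  gcongr
  exact EuclHyp.energyTPOrd_mono le_rfl (by norm_num)
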